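/- **Conventions.** For a quiver with finite node set $I$ and finitely many arrows $e$ (tail $t(e)$, head $h(e)$), a dimension vector $d\in\mathbb{N}^I$ and $\lambda\in\mathbb{C}^I$, let $W=\bigoplus_e \mathrm{Hom}(\mathbb{C}^{d_{t(e)}},\mathbb{C}^{d_{h(e)}})\oplus \mathrm{Hom}(\mathbb{C}^{d_{h(e)}},\mathbb{C}^{d_{t(e)}})$, with elements $(\varphi_e,\varphi_{e^*})_e$, let $\widetilde G=\prod_i \mathrm{GL}_{d_i}(\mathbb{C})$ act by change of basis, and let $\mu_i=\sum_{h(e)=i}\varphi_e\varphi_{e^*}-\sum_{t(e)=i}\varphi_{e^*}\varphi_e$. The quiver variety $N(\lambda)=\mu^{-1}(\lambda)/\widetilde G$ is the affine GIT quotient: the affine complex variety whose coordinate ring is the ring of $\widetilde G$-invariant regular functions on $\mu^{-1}(\lambda)=\{\mu_i=\lambda_i\cdot 1\ \forall i\}$. Let $\mathcal{Q}$ be a star-shaped quiver with $m\ge 3$ legs (each with at least one node), all arrows pointing towards the centre, with a dimension vector $\delta$ with positive entries and central dimension $N-1$. It is *almost affine* if the dimensions strictly decrease going down each leg; the last ($m$th)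 leg is full, i.e. has dimensions $N-1,N-2,\dots,2,1$ starting from the centre; and $\sum_{i=1}^m n_i=2(N-1)$, where $n_i$ is the dimension at the node adjacent to the centre on the $i$th leg. The *incremented quiver* $\mathcal{Q}^+$ with dimension vector $\Delta$ is obtained by lengthening the $m$th leg by one node and increasing by $1$ all dimensions on this leg, including that of the central node (so the new node has dimension $1$ and the centre has dimension $N$). Let $\lambda$ be parameters for $\mathcal{Q}^+$ (a complex number for each node), with components $\lambda_0$ at the centre and $\lambda_{ij}$ at the $j$th node from the centre on the $i$th leg. Let $w_i-1$ be the number of nodes on the $i$th leg of $\mathcal{Q}^+$, and put $\xi_{i1}=0$ and $\xi_{i,j+1}=-(\lambda_{i1}+\dots+\lambda_{ij})$ for $1\le j<w_i$. The orbit associated to the $i$th leg is the adjoint orbit of the $A\in\mathfrak{gl}_N(\mathbb{C})$ such that $\prod_{k\le w_i}(A-\xi_{ik})=0$ and $\mathrm{rank}\prod_{k\le j}(A-\xi_{ik})=\Delta_{ij}$ for $1\le j<w_i$. Call $\lambda$ *generic* if for every leg this orbit exists and is semisimple. The *projected parameters* $\mathrm{pr}(\lambda)$ for $\mathcal{Q}$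 are obtained as follows: first perform the scalar shift which replaces $\lambda_0$ by $0$ and $\lambda_{i1}$ by $\lambda_{i1}+\lambda_0$ for $i=1,\dots,m-1$, leaving all other components unchanged; then delete the central node, the first node of the $m$th leg becoming the new centre. Thus $\mathrm{pr}(\lambda)_0=\lambda_{m1}$, $\mathrm{pr}(\lambda)_{mj}=\lambda_{m,j+1}$, and, for $i<m$, $\mathrm{pr}(\lambda)_{i1}=\lambda_{i1}+\lambda_0$ and $\mathrm{pr}(\lambda)_{ij}=\lambda_{ij}$ for $j\ge 2$. **Lemma.** Let $(\mathcal{Q},\delta)$ be almost affine with incremented quiver $(\mathcal{Q}^+,\Delta)$, and let $\lambda$ be generic parameters for $\mathcal{Q}^+$ with $\lambda\cdot\Delta=0$. Then the quiver variety of $\mathcal{Q}^+$ (with dimension vector $\Delta$) with parameters $\lambda$ is isomorphic, as a complex variety, to the quiver variety of $\mathcal{Q}$ (with dimension vector $\delta$) with parameters $\mathrm{pr}(\lambda)$: $$N_{\mathcal{Q}^+}(\lambda)\cong N_{\mathcal{Q}}(\mathrm{pr}(\lambda)).$$ -/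

import Mathlib

open CategoryTheory AlgebraicGeometry Polynomial

noncomputable section

/-! ## Quiver varieties of a general finite quiver -/

section QuiverVariety

variable {V : Type} [Quiver.{0} V] [Fintype V] [∀ i j : V, Fintype (i ⟶ j)]

/-- The complex vector space `W` attached to a quiver and a dimension vector `d`: for every arrow
`e : i ⟶ j` a pair consisting of `φ_e ∈ Hom(ℂ^{d i}, ℂ^{d j})` and
`φ_{e*} ∈ Hom(ℂ^{d j}, ℂ^{d i})`. -/
abbrev RepSpace (d : V → ℕ) : Type :=
  ∀ (i j : V), (i ⟶ j) → Matrix (Fin (d j)) (Fin (d i)) ℂ × Matrix (Fin (d i)) (Fin (d j)) ℂ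

/-- The group `∏ᵢ GL(ℂ^{d i})`. -/
abbrev GaugeGroup (d : V → ℕ) : Type :=
  ∀ i : V, GL (Fin (d i)) ℂ

/-- The action of the gauge group: a map `φ : ℂ^{d i} → ℂ^{d j}` is sent to `g_j φ g_i⁻¹`. -/
def gaugeAct {d : V → ℕ} (g : GaugeGroup d) (x : RepSpace d) : RepSpace d :=
  fun i j e =>
    ((g j).val * (x i j e).1 * (g i)⁻¹.val, (g i).val * (x i j e).2 * (g j)⁻¹.val)

/-- The moment map: `μ_i = ∑_{h(e) = i} φ_e φ_{e*} - ∑_{t(e) = i} φ_{e*} φ_e`. -/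
def momentMap {d : V → ℕ} (x : RepSpace d) (i : V) : Matrix (Fin (d i)) (Fin (d i)) ℂ :=
  (∑ j : V, ∑ e : (j ⟶ i), (x j i e).1 * (x j i e).2) -
    ∑ j : V, ∑ e : (i ⟶ j), (x i j e).2 * (x i j e).1

/-- The fibre `μ⁻¹(lam)` over the central element given by the scalar matrices `lam i`. -/
def momentFibre (d : V → ℕ) (lam : V → ℂ) : Set (RepSpace d) :=
  {x | ∀ i : V, momentMap x i = Matrix.scalar (Fin (d i)) (lam i)}

/-- The coordinate ring of the affine variety `μ⁻¹(lam)`: the functions on it that are polynomials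
in the matrix entries. -/
def fibreCoordinateRing (d : V → ℕ) (lam : V → ℂ) : Subalgebra ℂ (momentFibre d lam → ℂ) :=
  Algebra.adjoin ℂ
    ({f | ∃ (i j : V) (e : i ⟶ j) (a : Fin (d j)) (b : Fin (d i)),
        f = fun x => (x.1 i j e).1 a b} ∪
     {f | ∃ (i j : V) (e : i ⟶ j) (a : Fin (d i)) (b : Fin (d j)),
        f = fun x => (x.1 i j e).2 a b})

/-- All functions on `μ⁻¹(lam)` that are constant on the orbits of the gauge group. -/
def gaugeInvariants (d : V → ℕ) (lam : V → ℂ) : Subalgebra ℂ (momentFibre d lam → ℂ) where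
  carrier := {f | ∀ (g : GaugeGroup d) (x y : momentFibre d lam),
    y.1 = gaugeAct g x.1 → f y = f x}
  mul_mem' := by
    intro f f' hf hf' g x y h
    simp only [Pi.mul_apply, hf g x y h, hf' g x y h]
  add_mem' := by
    intro f f' hf hf' g x y h
    simp only [Pi.add_apply, hf g x y h, hf' g x y h]
  algebraMap_mem' := by
    intro c g x y _
    rfl

/-- The ring of invariant regular functions on `μ⁻¹(lam)`. -/
def invariantRing (d : V → ℕ) (lam : V → ℂ) : Subalgebra ℂ (momentFibre d lam → ℂ) :=
  fibreCoordinateRing d lam ⊓ gaugeInvariants d lam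

/-- The quiver variety with dimension vector `d` and parameters `lam`, as a scheme over `ℂ`: the
affine GIT quotient of `μ⁻¹(lam)` by the gauge group, i.e. the affine variety whose coordinate ring
is the ring of invariant regular functions on `μ⁻¹(lam)`. -/
def quiverVariety (d : V → ℕ) (lam : V → ℂ) : Over (Spec (CommRingCat.of ℂ)) :=
  Over.mk (Spec.map (CommRingCat.ofHom (algebraMap ℂ (invariantRing d lam))))

end QuiverVariety

/-! ## Star-shaped quivers -/

/-- The nodes of the star-shaped quiver whose legs are indexed by `L`, the leg `i` having `len i`
nodes. The node `leg i j` is the `(j+1)`-st node on the leg `i`, counted from the centre. -/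
inductive StarVertex {L : Type} (len : L → ℕ) : Type
  | centre : StarVertex len
  | leg (i : L) (j : Fin (len i)) : StarVertex len

namespace StarVertex

variable {L : Type} {len : L → ℕ}

/-- Nodes as elements of `Option (Σ i, Fin (len i))`. -/
def equivOption (len : L → ℕ) : StarVertex len ≃ Option (Σ i, Fin (len i)) where
  toFun v := match v with
    | centre => none
    | leg i j => some ⟨i, j⟩
  invFun o := match o with
    | none => centre
    | some p => leg p.1 p.2
  left_inv v := by cases v <;> rfl
  right_inv o := by cases o <;> rfl

instance [Fintype L] : Fintype (StarVertex len) :=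
  Fintype.ofEquiv _ (equivOption len).symm

/-- There is an arrow from a node to the next one towards the centre. -/
def IsArrow : StarVertex len → StarVertex len → Prop
  | leg _ j, centre => j.val = 0
  | leg i j, leg i' j' => i = i' ∧ j.val = j'.val + 1
  | centre, _ => False

/-- The star-shaped quiver: one arrow from each non-central node to its neighbour on the same leg
in the direction of the centre. -/
instance : Quiver.{0} (StarVertex len) where
  Hom a b := PLift (IsArrow a b)

instance (a b : StarVertex len) : Fintype (a ⟶ b) :=
  @Fintype.ofFinite (PLift (IsArrow a b)) inferInstance

end StarVertex

/-- A star-shaped quiver with legs indexed by `L`, together with a dimension vector. -/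
structure StarData (L : Type) where
  /-- The number of nodes on each leg (the central node is not counted). -/
  len : L → ℕ
  /-- The dimension at the central node. -/
  centralDim : ℕ
  /-- The dimensions along each leg, going away from the centre. -/
  legDim : (i : L) → Fin (len i) → ℕ

namespace StarData

variable {L : Type}

/-- The nodes of the quiver. -/
abbrev Vertex (S : StarData L) : Type := StarVertex S.len

/-- The dimension vector. -/
def dim (S : StarData L) : S.Vertex → ℕ
  | .centre => S.centralDim
  | .leg i j => S.legDim i j

/-- The eigenvalues `0, -λ_{i1}, -λ_{i1} - λ_{i2}, …` attached to the leg `i` by the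
parameters `lam`; the index `t` runs over `0, …, len i`. -/
def legEigenvalue (S : StarData L) (lam : S.Vertex → ℂ) (i : L) (t : ℕ) : ℂ :=
  -∑ j : Fin (S.len i), if j.val < t then lam (.leg i j) else 0

/-- The adjoint orbit associated to the leg `i`: with `ξ₁, …, ξ_w` (`w = len i + 1`) the eigenvalues
attached to the leg, the matrices `A` of central size such that `(A - ξ₁)⋯(A - ξ_w) = 0` and
`rank (A - ξ₁)⋯(A - ξ_j)` is the dimension at the `j`-th node of the leg for each `j < w`. -/
def legOrbit (S : StarData L) (lam : S.Vertex → ℂ) (i : L) :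
    Set (Matrix (Fin S.centralDim) (Fin S.centralDim) ℂ) :=
  {A | aeval A (∏ t ∈ Finset.range (S.len i + 1), (X - C (S.legEigenvalue lam i t))) = 0 ∧
    ∀ j : Fin (S.len i),
      (aeval A (∏ t ∈ Finset.range (j.val + 1), (X - C (S.legEigenvalue lam i t)))).rank
        = S.legDim i j}

/-- Genericity of the parameters: the adjoint orbit of every leg is a semisimple orbit.
(Shifting an orbit by a scalar matrix does not affect this.) -/
def IsGeneric (S : StarData L) (lam : S.Vertex → ℂ) : Prop :=
  ∀ i : L, (S.legOrbit lam i).Nonempty ∧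
    ∀ A ∈ S.legOrbit lam i, Module.End.IsSemisimple (Matrix.toLin' A)

/-- A star-shaped quiver with `k + 1` legs, the distinguished (last) one being labelled `none`, is
almost affine: it has at least three legs, the (positive) dimensions strictly decrease going down
each leg, the last leg is full, i.e. from the centre on it has dimensions `n, n - 1, …, 2, 1`, and
the dimensions at the nodes adjacent to the centre add up to `2 n`, where `n` is the dimension at
the centre. -/
structure IsAlmostAffine {k : ℕ} (S : StarData (Option (Fin k))) : Prop where
  three_le : 3 ≤ k + 1
  len_pos : ∀ i, 0 < S.len i
  legDim_pos : ∀ i j, 0 < S.legDim i j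
  legDim_lt : ∀ i j, S.legDim i j < S.centralDim
  legDim_strictAnti : ∀ i, StrictAnti (S.legDim i)
  full_len : S.len none + 1 = S.centralDim
  full_dim : ∀ j : Fin (S.len none), S.legDim none j + (j.val + 1) = S.centralDim
  sum_eq : ∑ i, S.legDim i ⟨0, len_pos i⟩ = 2 * S.centralDim

variable {k : ℕ}

/-- The number of nodes on each leg once the last leg is lengthened by one node. -/
def incrementLen (len : Option (Fin k) → ℕ) : Option (Fin k) → ℕ
  | none => len none + 1
  | some i => len (some i)

/-- The incremented quiver: the last leg is lengthened by one node, and all the dimensions on this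
leg, including those of the central and of the new node, are increased by one. -/
def increment (S : StarData (Option (Fin k))) : StarData (Option (Fin k)) where
  len := incrementLen S.len
  centralDim := S.centralDim + 1
  legDim
    | none => fun j : Fin (S.len none + 1) =>
        if h : j.val < S.len none then S.legDim none ⟨j.val, h⟩ + 1 else 1
    | some i => fun j : Fin (S.len (some i)) => S.legDim (some i) j

/-- The scalar shift `λ(Λ)` of the parameters: the component at the centre is increased by `Λ`, the
components at the neighbours of the centre on all legs but the last are decreased by `Λ`. -/
def scalarShift (S : StarData (Option (Fin k))) (lam : S.Vertex → ℂ) (Lam : ℂ) :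
    S.Vertex → ℂ
  | .centre => lam .centre + Lam
  | .leg (some i) j => lam (.leg (some i) j) - if j.val = 0 then Lam else 0
  | .leg none j => lam (.leg none j)

/-- Deleting the central node of the incremented quiver and contracting the top of the last leg
turns parameters of the incremented quiver into parameters of the original quiver: the first node
of the last leg becomes the new centre. -/
def deleteCentre (S : StarData (Option (Fin k))) (lam : S.increment.Vertex → ℂ) :
    S.Vertex → ℂ
  | .centre => lam (.leg none (0 : Fin (S.len none + 1)))
  | .leg none j => lam (.leg none (Fin.succ j : Fin (S.len none + 1)))
  | .leg (some i) j => lam (.leg (some i) j)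

/-- The projected parameters `pr(λ)`: shift by the scalar that makes the central component zero,
then delete the central node. -/
def projectParams (S : StarData (Option (Fin k))) (lam : S.increment.Vertex → ℂ) :
    S.Vertex → ℂ :=
  S.deleteCentre (S.increment.scalarShift lam (-lam .centre))

end StarData

end

noncomputable section

/-! ## Rectangular factorisations and full legs -/

section FullLeg

open Matrix

/-! Write a point of either moment fibre as (P, Q, R, last leg): P and Q collect the maps between
the centre and its neighbours on the other legs, and R collects the remaining maps of those legs. If
n is the central dimension of `S`, these neighbours have total dimension 2n - (n - 1) = n + 1 for
both quivers, so the dual residue B = QP is a square matrix of size n + 1 in both cases. The moment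
equations on the other legs involve only B and R (`momentMap_outer`).

On a full leg the moment equations prescribe the characteristic polynomial of the residue at the
centre (`fullLeg_charpoly`). Genericity makes its roots ξ_t distinct
(`IsFull.legEigenvalue_injective`), and the leg is then recovered from its residue up to base change
(`fullLeg_rigid`). The moment equation at the centre says that PQ is the central parameter minus
this residue, so the spectrum of B is also prescribed. For the incremented quiver it consists of λ_0
- ξ_t with t = 0, …, n. For the original quiver it consists of -ξ_t with t = 1, …, n, together with
0 = -ξ_0 because B factors through dimension n. Both spectra are simple and they differ by λ_0.
Replacing B by B - λ_0 therefore matches the pairs (B, R) of the two quivers, and the change in the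
moment equations is the scalar shift in pr(λ).

It remains to see that invariants are polynomials in (B, R). In an eigenbasis of B the pair (P, Q)
reduces to scalars p_t, q_t whose product is an eigenvalue. If that eigenvalue is zero there are
several orbits over (B, R), but torus degenerations and continuity show that an invariant takes a
single value there (`invariant_eq_sec`). For regularity, the spectral projections of B give local
algebraic sections, defined where a product of their diagonal entries is nonzero. These products add
up to 1, so the local expressions glue (`invariantRing_le_dualRing`). -/

theorem Matrix.exists_mul_eq_one_of_rank {m n : ℕ} {A : Matrix (Fin m) (Fin n) ℂ}
    (h : A.rank = m) : ∃ B : Matrix (Fin n) (Fin m) ℂ, A * B = 1 := by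
  rw [← Matrix.mulVec_surjective_iff_exists_right_inverse]
  have h1 : LinearMap.range A.mulVecLin = ⊤ := by
    apply Submodule.eq_top_of_finrank_eq
    rw [Module.finrank_fin_fun]
    exact h
  exact LinearMap.range_eq_top.mp h1

theorem Matrix.exists_mul_eq_one_of_rank' {m n : ℕ} {A : Matrix (Fin m) (Fin n) ℂ}
    (h : A.rank = n) : ∃ B : Matrix (Fin n) (Fin m) ℂ, B * A = 1 := by
  obtain ⟨B, hB⟩ := Matrix.exists_mul_eq_one_of_rank (A := Aᵀ) (by rw [Matrix.rank_transpose, h])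
  exact ⟨Bᵀ, by rw [← Matrix.transpose_transpose A, ← Matrix.transpose_mul, hB,
    Matrix.transpose_one]⟩

/-- Two factorisations of a matrix through a space of dimension equal to its rank differ by an
invertible matrix. -/
theorem Matrix.exists_gl_of_mul_eq_mul {r d : ℕ} {b b' : Matrix (Fin r) (Fin d) ℂ}
    {a a' : Matrix (Fin d) (Fin r) ℂ} (h : b * a = b' * a') (hr : (b * a).rank = d) :
    (∃ α : Matrix (Fin r) (Fin d) ℂ, a * α = 1) ∧ (∃ β : Matrix (Fin d) (Fin r) ℂ, β * b' = 1) ∧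
      ∃ g : GL (Fin d) ℂ, g.val * a = a' ∧ b' * g.val = b := by
  have ha : a.rank = d :=
    le_antisymm (by simpa using a.rank_le_card_height) (hr.symm.le.trans (Matrix.rank_mul_le_right b a))
  have hb : b.rank = d :=
    le_antisymm (by simpa using b.rank_le_card_width) (hr.symm.le.trans (Matrix.rank_mul_le_left b a))
  have hb' : b'.rank = d :=
    le_antisymm (by simpa using b'.rank_le_card_width)
      (hr.symm.le.trans (h ▸ Matrix.rank_mul_le_left b' a'))
  obtain ⟨α, hα⟩ := Matrix.exists_mul_eq_one_of_rank ha
  obtain ⟨β, hβ⟩ := Matrix.exists_mul_eq_one_of_rank' hb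
  obtain ⟨β', hβ'⟩ := Matrix.exists_mul_eq_one_of_rank' hb'
  -- The comparison map is β' b = a' α. The two expressions together show that it intertwines both
  -- pairs of factors.
  have e1 : β' * b = a' * α := by
    calc β' * b = β' * (b * a) * α := by
          rw [Matrix.mul_assoc, Matrix.mul_assoc b, hα, Matrix.mul_one]
      _ = a' * α := by rw [h, ← Matrix.mul_assoc, hβ', Matrix.one_mul]
  have e2 : b' * (β' * b) = b := by
    rw [e1, ← Matrix.mul_assoc, ← h, Matrix.mul_assoc, hα, Matrix.mul_one]
  have e3 : (β * b') * (β' * b) = 1 := by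
    rw [Matrix.mul_assoc, e2, hβ]
  refine ⟨⟨α, hα⟩, ⟨β', hβ'⟩,
    ⟨β' * b, β * b', mul_eq_one_comm.mp e3, e3⟩, ?_, e2⟩
  change β' * b * a = a'
  rw [Matrix.mul_assoc, h, ← Matrix.mul_assoc, hβ', Matrix.one_mul]

theorem Matrix.charpoly_of_sub_scalar {n : ℕ} (A B : Matrix (Fin n) (Fin n) ℂ) (c : ℂ)
    (h : A - B = Matrix.scalar (Fin n) c) : B.charpoly = A.charpoly.comp (X + C c) := by
  rw [← Matrix.charpoly_sub_scalar, ← h, sub_sub_cancel]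

/-- Induction from the tip of the leg, m being the distance to it. Dimensions drop by one at each
node, so passing from QP to PQ contributes one factor X, while the moment equation translates the
variable by a difference of consecutive ξ. -/
theorem fullLeg_charpoly (d : ℕ → ℕ) (P : ∀ j, Matrix (Fin (d j)) (Fin (d (j + 1))) ℂ)
    (Q : ∀ j, Matrix (Fin (d (j + 1))) (Fin (d j)) ℂ) (ξ : ℕ → ℂ) (l : ℕ)
    (hd : ∀ j ≤ l, d j + j = l + 1)
    (hPQ : ∀ j < l, P (j + 1) * Q (j + 1) - Q j * P j = Matrix.scalar _ (ξ j - ξ (j + 1)))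
    (hl : P l * Q l = 0) (m : ℕ) :
    ∀ j, j + m = l →
      (P j * Q j).charpoly = ∏ t ∈ Finset.range (m + 1), (X - C (ξ (j + t) - ξ j)) := by
  induction m with
  | zero =>
    rintro j rfl
    have h := hd j le_rfl
    have h1 : d j = 1 := by omega
    have hl' : P j * Q j = 0 := hl
    rw [hl', Matrix.charpoly_zero]
    simp [h1]
  | succ m ih =>
    intro j hj
    have h1 := hd j (by omega)
    have h2 := hd (j + 1) (by omega)
    have h3 := ih (j + 1) (by omega)
    rw [Matrix.charpoly_mul_comm_of_le _ _ (by simp; omega),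
      Matrix.charpoly_of_sub_scalar _ _ _ (hPQ j (by omega)), h3, Finset.prod_range_succ' _ (m + 1),
      Polynomial.prod_comp]
    have h4 : d j - d (j + 1) = 1 := by omega
    simp only [Fintype.card_fin, h4, pow_one, add_zero, sub_self, C_0, sub_zero]
    rw [mul_comm]
    congr 1
    refine Finset.prod_congr rfl fun t _ => ?_
    simp only [sub_comp, X_comp, C_comp, C_sub]
    rw [show j + 1 + t = j + (t + 1) by ring]
    ring

/-- The composite of the maps of a leg going outwards from the node `0`. -/
def legOut {d : ℕ → ℕ} (Q : ∀ j, Matrix (Fin (d (j + 1))) (Fin (d j)) ℂ) :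
    ∀ j, Matrix (Fin (d j)) (Fin (d 0)) ℂ
  | 0 => 1
  | j + 1 => Q j * legOut Q j

/-- The composite of the maps of a leg going inwards to the node `0`. -/
def legIn {d : ℕ → ℕ} (P : ∀ j, Matrix (Fin (d j)) (Fin (d (j + 1))) ℂ) :
    ∀ j, Matrix (Fin (d 0)) (Fin (d j)) ℂ
  | 0 => 1
  | j + 1 => legIn P j * P j

/-- The moment equations let a residue be pushed through the outgoing maps one node at a time. The
scalars telescope to ξ j because ξ 0 = 0. -/
theorem mul_mul_legOut (d : ℕ → ℕ) (P : ∀ j, Matrix (Fin (d j)) (Fin (d (j + 1))) ℂ)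
    (Q : ∀ j, Matrix (Fin (d (j + 1))) (Fin (d j)) ℂ) (ξ : ℕ → ℂ) (l : ℕ) (hξ : ξ 0 = 0)
    (hPQ : ∀ j < l, P (j + 1) * Q (j + 1) - Q j * P j = Matrix.scalar _ (ξ j - ξ (j + 1)))
    (j : ℕ) (hj : j ≤ l) :
    P j * Q j * legOut Q j = legOut Q j * (P 0 * Q 0 - Matrix.scalar _ (ξ j)) := by
  induction j with
  | zero => simp [legOut, hξ]
  | succ j ih =>
    have ih' := ih (by omega)
    rw [sub_eq_iff_eq_add.mp (hPQ j (by omega)), legOut, Matrix.add_mul,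
      Matrix.mul_assoc (Q j) (P j), ← Matrix.mul_assoc (P j), ih']
    have e : ∀ c : ℂ, ∀ n : ℕ, Matrix.scalar (Fin n) c = c • (1 : Matrix (Fin n) (Fin n) ℂ) := by
      intro c n
      rw [Matrix.smul_one_eq_diagonal]; rfl
    simp only [e, Matrix.mul_sub, Matrix.mul_smul, Matrix.smul_mul, Matrix.mul_one,
      Matrix.one_mul, Matrix.mul_assoc, Matrix.sub_mul, sub_smul]
    abel

/-- Going out to node j and back depends only on the residue at node 0: by `mul_mul_legOut`, each
further node contributes one factor of the polynomial. This is why the residue determines the whole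
leg. -/
theorem legIn_mul_legOut (d : ℕ → ℕ) (P : ∀ j, Matrix (Fin (d j)) (Fin (d (j + 1))) ℂ)
    (Q : ∀ j, Matrix (Fin (d (j + 1))) (Fin (d j)) ℂ) (ξ : ℕ → ℂ) (l : ℕ) (hξ : ξ 0 = 0)
    (hPQ : ∀ j < l, P (j + 1) * Q (j + 1) - Q j * P j = Matrix.scalar _ (ξ j - ξ (j + 1)))
    (j : ℕ) (hj : j ≤ l) :
    legIn P j * legOut Q j = aeval (P 0 * Q 0) (∏ t ∈ Finset.range j, (X - C (ξ t))) := by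
  induction j with
  | zero => simp [legOut, legIn]
  | succ j ih =>
    have ih' := ih (by omega)
    rw [legIn, legOut, Finset.prod_range_succ, map_mul, ← ih', Matrix.mul_assoc,
      ← Matrix.mul_assoc (P j), mul_mul_legOut d P Q ξ l hξ hPQ j (by omega), Matrix.mul_assoc]
    simp
    rfl

/-- Two representations of a full leg with the same residue at the node `0` are related by base
changes at the other nodes. -/
theorem fullLeg_rigid (d : ℕ → ℕ) (P P' : ∀ j, Matrix (Fin (d j)) (Fin (d (j + 1))) ℂ)
    (Q Q' : ∀ j, Matrix (Fin (d (j + 1))) (Fin (d j)) ℂ) (ξ : ℕ → ℂ) (l : ℕ) (hξ : ξ 0 = 0)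
    (hPQ : ∀ j < l, P (j + 1) * Q (j + 1) - Q j * P j = Matrix.scalar _ (ξ j - ξ (j + 1)))
    (hPQ' : ∀ j < l, P' (j + 1) * Q' (j + 1) - Q' j * P' j = Matrix.scalar _ (ξ j - ξ (j + 1)))
    (hr : ∀ j ≤ l, (aeval (P 0 * Q 0) (∏ t ∈ Finset.range j, (X - C (ξ t)))).rank = d j)
    (h : P 0 * Q 0 = P' 0 * Q' 0) :
    ∃ g : ∀ j, GL (Fin (d j)) ℂ, g 0 = 1 ∧ ∀ j < l,
      (g (j + 1)).val * Q j = Q' j * (g j).val ∧ P' j * (g (j + 1)).val = (g j).val * P j := by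
  -- For each j these are two factorisations of the same matrix, whose rank is the dimension of node
  -- j, so they differ by a unique base change there.
  have key : ∀ j ≤ l, legIn P j * legOut Q j = legIn P' j * legOut Q' j := fun j hj => by
    rw [legIn_mul_legOut d P Q ξ l hξ hPQ j hj, legIn_mul_legOut d P' Q' ξ l hξ hPQ' j hj, h]
  have key2 : ∀ j ≤ l, (legIn P j * legOut Q j).rank = d j := fun j hj => by
    rw [legIn_mul_legOut d P Q ξ l hξ hPQ j hj, hr j hj]
  have ex : ∀ j, ∃ g : GL (Fin (d j)) ℂ, j ≤ l →
      g.val * legOut Q j = legOut Q' j ∧ legIn P' j * g.val = legIn P j := by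
    intro j
    by_cases hj : j ≤ l
    · obtain ⟨-, -, g, hg⟩ := Matrix.exists_gl_of_mul_eq_mul (key j hj) (key2 j hj)
      exact ⟨g, fun _ => hg⟩
    · exact ⟨1, fun h => absurd h hj⟩
  choose g hg using ex
  refine ⟨g, ?_, fun j hj => ?_⟩
  · have := (hg 0 (Nat.zero_le _)).1
    simp only [legOut, Matrix.mul_one] at this
    exact Units.ext this
  · obtain ⟨⟨α, hα⟩, -, -⟩ := Matrix.exists_gl_of_mul_eq_mul (key j hj.le) (key2 j hj.le)
    obtain ⟨-, ⟨β, hβ⟩, -⟩ := Matrix.exists_gl_of_mul_eq_mul (key j hj.le) (key2 j hj.le)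
    obtain ⟨h1, h2⟩ := hg j hj.le
    obtain ⟨h3, h4⟩ := hg (j + 1) hj
    simp only [legOut, legIn] at h3 h4
    constructor
    -- The compatibilities hold after composing with the maps to or from node 0. The outgoing
    -- composite has a right inverse α and the incoming one a left inverse β, so both can be
    -- cancelled.
    · have : (g (j + 1)).val * Q j * legOut Q j = Q' j * (g j).val * legOut Q j := by
        rw [Matrix.mul_assoc, h3, Matrix.mul_assoc, h1]
      simpa [Matrix.mul_assoc, hα] using congrArg (· * α) this
    · have : legIn P' j * (P' j * (g (j + 1)).val) = legIn P' j * ((g j).val * P j) := by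
        rw [← Matrix.mul_assoc, h4, ← Matrix.mul_assoc, h2]
      simpa [← Matrix.mul_assoc, hβ] using congrArg (β * ·) this

end FullLeg

/-! ## Matrices with simple spectrum -/

section SimpleSpectrum

open Matrix

variable {T K : Type} [Fintype T] [DecidableEq T] [Fintype K] [DecidableEq K]

/-- Distinct roots give independent eigenvectors, and there are enough of them to form a basis.
Eigenvalues have their own index type K because the dual residue is indexed by basis vectors of the
outer neighbours, which have no natural enumeration by eigenvalues. -/
theorem Matrix.exists_diagonalisation (M : Matrix T T ℂ) (c : K → ℂ) (hc : Function.Injective c)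
    (hcard : Fintype.card T = Fintype.card K) (hM : M.charpoly = ∏ k, (X - C (c k))) :
    ∃ (g : Matrix T K ℂ) (g' : Matrix K T ℂ), g * g' = 1 ∧ g' * g = 1 ∧
      M * g = g * Matrix.diagonal c := by
  have hev : ∀ k, ∃ v, Module.End.HasEigenvector (Matrix.toLin' M) (c k) v := fun k => by
    have : Module.End.HasEigenvalue (Matrix.toLin' M) (c k) := by
      rw [Module.End.hasEigenvalue_iff_isRoot_charpoly, Matrix.charpoly_toLin', hM,
        Polynomial.IsRoot.def, Polynomial.eval_prod]
      exact Finset.prod_eq_zero (Finset.mem_univ k) (by simp)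
    exact this.exists_hasEigenvector
  choose v hv using hev
  have hli := Module.End.eigenvectors_linearIndependent' (Matrix.toLin' M) c hc v hv
  let e : T ≃ K := Fintype.equivOfCardEq hcard
  let g0 : Matrix T T ℂ := Matrix.of fun t s => v (e s) t
  have hu : IsUnit g0 := by
    rw [← Matrix.linearIndependent_cols_iff_isUnit]
    exact hli.comp e e.injective
  obtain ⟨w, hw⟩ := hu
  refine ⟨Matrix.of fun t k => v k t, (w⁻¹).val.submatrix e.symm id, ?_, ?_, ?_⟩
  · have h1 : g0 * (w⁻¹).val = 1 := by rw [← hw]; simp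
    rw [← h1]
    ext t s
    simp only [Matrix.mul_apply, g0]
    exact (Equiv.sum_comp e _).symm.trans (by simp)
  · have h1 : (w⁻¹).val * g0 = 1 := by rw [← hw]; simp
    ext k l
    have := congrFun (congrFun h1 (e.symm k)) (e.symm l)
    simp only [Matrix.mul_apply, g0, Matrix.of_apply, Equiv.apply_symm_apply] at this ⊢
    simpa [Matrix.one_apply] using this
  · ext t k
    have := congrFun (hv k).apply_eq_smul t
    rw [Matrix.mul_diagonal, Matrix.mul_apply]
    simpa [Matrix.mulVec, dotProduct, mul_comm] using this

theorem Matrix.aeval_mul_of_mul_eq {M : Matrix T T ℂ} {g : Matrix T K ℂ} {c : K → ℂ}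
    (h : M * g = g * Matrix.diagonal c) (p : ℂ[X]) :
    aeval M p * g = g * Matrix.diagonal (fun k => p.eval (c k)) := by
  induction p using Polynomial.induction_on' with
  | add p q hp hq =>
    rw [map_add, Matrix.add_mul, hp, hq, ← Matrix.mul_add, Matrix.diagonal_add]
    simp
  | monomial n a =>
    rw [Polynomial.aeval_monomial, Matrix.algebraMap_eq_diagonal]
    induction n with
    | zero =>
      ext t k
      simp [mul_comm]
    | succ n ih =>
      rw [pow_succ, ← mul_assoc, Matrix.mul_assoc _ M, h, ← Matrix.mul_assoc, ih,
        Matrix.mul_assoc, Matrix.diagonal_mul_diagonal]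
      simp [pow_succ, mul_assoc]

theorem Matrix.rank_aeval_of_charpoly {n : ℕ} (M : Matrix (Fin n) (Fin n) ℂ) (c : Fin n → ℂ)
    (hc : Function.Injective c) (hM : M.charpoly = ∏ k, (X - C (c k))) (p : ℂ[X]) :
    (aeval M p).rank = Fintype.card {k // p.eval (c k) ≠ 0} := by
  obtain ⟨g, g', h1, h2, h3⟩ := M.exists_diagonalisation c hc rfl hM
  have h4 := Matrix.aeval_mul_of_mul_eq h3 p
  have hu : IsUnit g.det := (Matrix.isUnit_iff_isUnit_det g).mp ⟨⟨g, g', h1, h2⟩, rfl⟩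
  rw [← Matrix.rank_mul_eq_left_of_isUnit_det g _ hu, h4,
    Matrix.rank_mul_eq_right_of_isUnit_det g _ hu, Matrix.rank_diagonal]

end SimpleSpectrum

/-! ## Genericity of a full leg -/

/-- Since q commutes with f, the vector q v lies in the second generalised eigenspace, which for a
semisimple endomorphism is the eigenspace itself. -/
theorem LinearMap.ker_mul_sub_sq_eq {E : Type} [AddCommGroup E] [Module ℂ E] [FiniteDimensional ℂ E]
    (f : Module.End ℂ E) (hf : f.IsSemisimple) (μ : ℂ) (q : Module.End ℂ E) (hq : Commute f q)
    (v : E) (hv : (q * ((f - algebraMap ℂ _ μ) * (f - algebraMap ℂ _ μ))) v = 0) :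
    (q * (f - algebraMap ℂ _ μ)) v = 0 := by
  set u := f - algebraMap ℂ (Module.End ℂ E) μ with hu
  have hqu : Commute u q := hq.sub_left (Algebra.commute_algebraMap_left μ q)
  have h1 : (u ^ 2) (q v) = 0 := by
    rw [← Module.End.mul_apply, (hqu.pow_left 2).eq, pow_two]; exact hv
  have h2 := hf.isFinitelySemisimple.genEigenspace_eq_eigenspace μ (k := 2) (by norm_num)
  have h3 : q v ∈ f.genEigenspace μ 2 := by
    have := Module.End.mem_genEigenspace_nat (f := f) (μ := μ) (k := 2) (x := q v)
    refine this.mpr (LinearMap.mem_ker.mpr ?_)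
    rw [← Algebra.algebraMap_eq_smul_one]
    exact h1
  rw [h2, Module.End.mem_eigenspace_iff] at h3
  rw [← hqu.eq, Module.End.mul_apply, hu, LinearMap.sub_apply, h3, Module.algebraMap_end_apply,
    sub_self]

/-- For a semisimple matrix a repeated linear factor does not lower the rank any further. This turns
semisimplicity of an orbit into distinctness of its eigenvalues. -/
theorem Matrix.rank_mul_sub_sq_eq {n : ℕ} (A : Matrix (Fin n) (Fin n) ℂ)
    (hA : Module.End.IsSemisimple (Matrix.toLin' A)) (μ : ℂ) (q : ℂ[X]) :
    (aeval A (q * (X - C μ) * (X - C μ))).rank = (aeval A (q * (X - C μ))).rank := by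
  have key : ∀ p : ℂ[X], Matrix.toLin' (aeval A p) =
      aeval (Matrix.toLin' A : Module.End ℂ (Fin n → ℂ)) p := fun p =>
    (Polynomial.aeval_algHom_apply (Matrix.toLinAlgEquiv' (R := ℂ) (n := Fin n)) A p).symm
  have hk : LinearMap.ker (Matrix.toLin' (aeval A (q * (X - C μ) * (X - C μ)))) =
      LinearMap.ker (Matrix.toLin' (aeval A (q * (X - C μ)))) := by
    rw [key, key]
    generalize (Matrix.toLin' A : Module.End ℂ (Fin n → ℂ)) = f at hA
    ext v
    have hX : aeval f (X - C μ) = f - algebraMap ℂ _ μ := by simp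
    simp only [LinearMap.mem_ker]
    constructor
    · intro h
      rw [map_mul, hX]
      refine LinearMap.ker_mul_sub_sq_eq _ hA μ _ ?_ v ?_
      · simpa using (Commute.all X q).map (aeval f)
      · rwa [map_mul, map_mul, hX, mul_assoc] at h
    · intro h
      rw [mul_comm, map_mul, Module.End.mul_apply, h, map_zero]
  have h1 := LinearMap.finrank_range_add_finrank_ker
    (Matrix.toLin' (aeval A (q * (X - C μ) * (X - C μ))))
  have h2 := LinearMap.finrank_range_add_finrank_ker (Matrix.toLin' (aeval A (q * (X - C μ))))
  rw [hk] at h1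
  have h3 := Nat.add_right_cancel (h1.trans h2.symm)
  exact h3

namespace StarData

variable {k : ℕ}

/-- The last leg is full. -/
structure IsFull (S : StarData (Option (Fin k))) : Prop where
  len : S.len none + 1 = S.centralDim
  dim : ∀ j : Fin (S.len none), S.legDim none j + (j.val + 1) = S.centralDim

theorem IsAlmostAffine.isFull {S : StarData (Option (Fin k))} (h : S.IsAlmostAffine) : S.IsFull :=
  ⟨h.full_len, h.full_dim⟩

theorem IsFull.increment {S : StarData (Option (Fin k))} (h : S.IsFull) : S.increment.IsFull := by
  refine ⟨congrArg (· + 1) h.len, fun j => ?_⟩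
  change (if h : j.val < S.len none then S.legDim none ⟨j.val, h⟩ + 1 else 1) + (j.val + 1) =
    S.centralDim + 1
  have hj : j.val < S.len none + 1 := j.2
  have := h.len
  split_ifs with h1
  · have := h.dim ⟨j.val, h1⟩
    simp only at this
    omega
  · omega

/-- On a full leg every new factor must lower the rank by exactly one. If ξ s = ξ t with s < t, the
factor for t repeats an earlier one and semisimplicity leaves the rank unchanged, a contradiction.
-/
theorem IsFull.legEigenvalue_injective {S : StarData (Option (Fin k))} (h : S.IsFull)
    (lam : S.Vertex → ℂ) (hgen : S.IsGeneric lam) :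
    Function.Injective fun t : Fin S.centralDim => S.legEigenvalue lam none t := by
  obtain ⟨⟨A, hA⟩, hss⟩ := hgen none
  have hsA := hss A hA
  obtain ⟨hA1, hA2⟩ := hA
  set ξ := S.legEigenvalue lam none
  have hrank : ∀ t ≤ S.centralDim,
      (aeval A (∏ t ∈ Finset.range t, (X - C (ξ t)))).rank + t = S.centralDim := by
    intro t ht
    rcases t with _ | t
    · simp
    · rcases Nat.lt_or_ge t (S.len none) with h1 | h1
      · have h2 := hA2 ⟨t, h1⟩
        have h3 := h.dim ⟨t, h1⟩
        simp only at h2 h3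
        omega
      -- The last drop, to rank zero, is the annihilating equation of the orbit rather than one of
      -- its rank conditions.
      · have : t = S.len none := by have := h.len; omega
        subst this
        rw [hA1, Matrix.rank_zero, zero_add, h.len]
  have key : ∀ s t : ℕ, s < t → t < S.centralDim → ξ s ≠ ξ t := by
    intro s t hst ht heq
    have h1 := hrank t ht.le
    have h2 := hrank (t + 1) ht
    rw [Finset.prod_range_succ, ← Finset.prod_erase_mul _ _ (Finset.mem_range.mpr hst), heq,
      Matrix.rank_mul_sub_sq_eq A hsA] at h2
    rw [← Finset.prod_erase_mul _ _ (Finset.mem_range.mpr hst), heq] at h1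
    omega
  intro s t hst
  rcases lt_trichotomy s.val t.val with h1 | h1 | h1
  · exact absurd hst (key _ _ h1 t.2)
  · exact Fin.ext h1
  · exact absurd hst.symm (key _ _ h1 s.2)

end StarData

/-! ## The gauge action and the moment map -/

section Gauge

variable {V : Type} [Quiver.{0} V] [Fintype V] [∀ i j : V, Fintype (i ⟶ j)] {d : V → ℕ}


theorem momentMap_gaugeAct (g : GaugeGroup d) (x : RepSpace d) (i : V) :
    momentMap (gaugeAct g x) i = (g i).val * momentMap x i * (g i)⁻¹.val := by
  have e : ∀ j : V, (g j)⁻¹.val * (g j).val = 1 := fun j => by simp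
  simp only [momentMap, gaugeAct, Matrix.mul_sub, Matrix.sub_mul, Matrix.mul_sum, Matrix.sum_mul]
  congr 1
  · refine Finset.sum_congr rfl fun j _ => Finset.sum_congr rfl fun a _ => ?_
    simp only [Matrix.mul_assoc]
    rw [← Matrix.mul_assoc (g j)⁻¹.val, e, Matrix.one_mul]
  · refine Finset.sum_congr rfl fun j _ => Finset.sum_congr rfl fun a _ => ?_
    simp only [Matrix.mul_assoc]
    rw [← Matrix.mul_assoc (g j)⁻¹.val, e, Matrix.one_mul]

theorem gaugeAct_mem_momentFibre {lam : V → ℂ} (g : GaugeGroup d) {x : RepSpace d}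
    (hx : x ∈ momentFibre d lam) : gaugeAct g x ∈ momentFibre d lam := by
  intro i
  rw [momentMap_gaugeAct, hx i, ← (Matrix.scalar_commute (lam i) (fun r => mul_comm _ _) _).eq,
    Matrix.mul_assoc, ← Units.val_mul, mul_inv_cancel, Units.val_one, Matrix.mul_one]

end Gauge

/-! ## Representations of star-shaped quivers -/

namespace StarVertex

variable {L : Type} {len : L → ℕ} {d : StarVertex len → ℕ}

instance (v w : StarVertex len) : Subsingleton (v ⟶ w) :=
  inferInstanceAs (Subsingleton (PLift (IsArrow v w)))

open Classical in
/-- The map `φ_e` for the arrow `e` from `v` to `w`, or zero if there is none. -/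
def fwd (x : RepSpace d) (v w : StarVertex len) : Matrix (Fin (d w)) (Fin (d v)) ℂ :=
  if h : IsArrow v w then (x v w ⟨h⟩).1 else 0

open Classical in
/-- The map `φ_{e*}` for the arrow `e` from `v` to `w`, or zero if there is none. -/
def bwd (x : RepSpace d) (v w : StarVertex len) : Matrix (Fin (d v)) (Fin (d w)) ℂ :=
  if h : IsArrow v w then (x v w ⟨h⟩).2 else 0

theorem fwd_arrow (x : RepSpace d) {v w : StarVertex len} (e : v ⟶ w) :
    fwd x v w = (x v w e).1 := dif_pos e.down

theorem bwd_arrow (x : RepSpace d) {v w : StarVertex len} (e : v ⟶ w) :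
    bwd x v w = (x v w e).2 := dif_pos e.down

theorem fwd_eq_zero (x : RepSpace d) {v w : StarVertex len} (h : ¬ IsArrow v w) :
    fwd x v w = 0 := dif_neg h

theorem bwd_eq_zero (x : RepSpace d) {v w : StarVertex len} (h : ¬ IsArrow v w) :
    bwd x v w = 0 := dif_neg h

theorem rep_ext {x y : RepSpace d} (hf : ∀ v w, IsArrow v w → fwd x v w = fwd y v w)
    (hb : ∀ v w, IsArrow v w → bwd x v w = bwd y v w) : x = y := by
  funext v w e
  exact Prod.ext (by rw [← fwd_arrow, ← fwd_arrow, hf v w e.down])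
    (by rw [← bwd_arrow, ← bwd_arrow, hb v w e.down])

theorem fwd_gaugeAct (g : GaugeGroup d) (x : RepSpace d) (v w : StarVertex len) :
    fwd (gaugeAct g x) v w = (g w).val * fwd x v w * (g v)⁻¹.val := by
  by_cases h : IsArrow v w
  · rw [fwd_arrow _ ⟨h⟩, fwd_arrow _ ⟨h⟩]; rfl
  · simp [fwd_eq_zero _ h]

theorem bwd_gaugeAct (g : GaugeGroup d) (x : RepSpace d) (v w : StarVertex len) :
    bwd (gaugeAct g x) v w = (g v).val * bwd x v w * (g w)⁻¹.val := by
  by_cases h : IsArrow v w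
  · rw [bwd_arrow _ ⟨h⟩, bwd_arrow _ ⟨h⟩]; rfl
  · simp [bwd_eq_zero _ h]

theorem sum_arrow {A : Type} [AddCommMonoid A] (v w : StarVertex len) (f : (v ⟶ w) → A) (a : A)
    (h : ∀ e, f e = a) (h' : ¬ IsArrow v w → a = 0) : ∑ e, f e = a := by
  by_cases hvw : IsArrow v w
  · rw [Fintype.sum_subsingleton f ⟨hvw⟩, h]
  · rw [h' hvw]
    exact Finset.sum_eq_zero fun e _ => absurd e.down hvw

theorem momentMap_eq [Fintype L] (x : RepSpace d) (i : StarVertex len) :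
    momentMap x i = (∑ j, fwd x j i * bwd x j i) - ∑ j, bwd x i j * fwd x i j := by
  rw [momentMap]
  congr 1
  · refine Finset.sum_congr rfl fun j _ => sum_arrow _ _ _ _ (fun e => ?_) fun h => ?_
    · rw [fwd_arrow x e, bwd_arrow x e]
    · rw [fwd_eq_zero x h, Matrix.zero_mul]
  · refine Finset.sum_congr rfl fun j _ => sum_arrow _ _ _ _ (fun e => ?_) fun h => ?_
    · rw [fwd_arrow x e, bwd_arrow x e]
    · rw [fwd_eq_zero x h, Matrix.mul_zero]

theorem sum_vertex [Fintype L] {A : Type} [AddCommMonoid A] (f : StarVertex len → A) :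
    ∑ v, f v = f centre + ∑ i, ∑ j, f (leg i j) := by
  rw [← (equivOption len).symm.sum_comp, Fintype.sum_option, Fintype.sum_sigma]
  rfl

theorem not_isArrow_centre (v : StarVertex len) : ¬ IsArrow centre v := by
  cases v <;> exact id

/-- The distance from the centre. -/
def depth : StarVertex len → ℕ
  | centre => 0
  | leg _ j => j.val + 1

end StarVertex

open StarVertex

namespace StarData

variable {k : ℕ} (S : StarData (Option (Fin k)))

/-- The nodes on the legs other than the last one. -/
abbrev OuterNode : Type := Σ i : Fin k, Fin (S.len (some i))

/-- The node of the quiver given by a node on a leg other than the last one. -/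
abbrev outer (p : S.OuterNode) : S.Vertex := .leg (some p.1) p.2

/-- A basis of the sum of the spaces at the neighbours of the centre, the last leg excepted. -/
abbrev OuterIndex : Type :=
  Σ p : {p : S.OuterNode // p.2.val = 0}, Fin (S.dim (S.outer p.1))

/-- The maps between nodes on the legs other than the last one. -/
abbrev OuterRep : Type :=
  ∀ p q : S.OuterNode, Matrix (Fin (S.dim (S.outer q))) (Fin (S.dim (S.outer p))) ℂ ×
    Matrix (Fin (S.dim (S.outer p))) (Fin (S.dim (S.outer q))) ℂ

variable {S}

/-- The maps to the centre from all its neighbours outside the last leg. -/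
def toCentre (x : RepSpace S.dim) : Matrix (Fin (S.dim .centre)) S.OuterIndex ℂ :=
  Matrix.of fun q t => fwd x (S.outer t.1.1) .centre q t.2

/-- The maps from the centre to all its neighbours outside the last leg. -/
def fromCentre (x : RepSpace S.dim) : Matrix S.OuterIndex (Fin (S.dim .centre)) ℂ :=
  Matrix.of fun t q => bwd x (S.outer t.1.1) .centre t.2 q

/-- The maps between nodes on the legs other than the last one. -/
def outerRep (x : RepSpace S.dim) : S.OuterRep := fun p q =>
  (fwd x (S.outer p) (S.outer q), bwd x (S.outer p) (S.outer q))

/-- The dual residue: the composite through the centre. -/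
def dualResidue (x : RepSpace S.dim) : Matrix S.OuterIndex S.OuterIndex ℂ :=
  fromCentre x * toCentre x

/-- The part of the moment map that comes from the maps between nodes on the legs other than the
last one. -/
def outerMoment (R : S.OuterRep) (p : S.OuterNode) :
    Matrix (Fin (S.dim (S.outer p))) (Fin (S.dim (S.outer p))) ℂ :=
  (∑ q, (R q p).1 * (R q p).2) - ∑ q, (R p q).2 * (R p q).1

/-- The diagonal blocks of a matrix. -/
def block (M : Matrix S.OuterIndex S.OuterIndex ℂ) (p : S.OuterNode) :
    Matrix (Fin (S.dim (S.outer p))) (Fin (S.dim (S.outer p))) ℂ :=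
  if h : p.2.val = 0 then Matrix.of fun a b => M ⟨⟨p, h⟩, a⟩ ⟨⟨p, h⟩, b⟩ else 0

theorem outerRep_eq_zero (x : RepSpace S.dim) {p q : S.OuterNode}
    (h : ¬ IsArrow (S.outer p) (S.outer q)) : outerRep x p q = 0 :=
  Prod.ext (fwd_eq_zero x h) (bwd_eq_zero x h)

/-- An outer node is adjacent only to nodes of its own leg and possibly to the centre, whose
contribution is a diagonal block of the dual residue. Hence these equations are conditions on the
pair (dual residue, outer maps) alone. -/
theorem momentMap_outer (x : RepSpace S.dim) (p : S.OuterNode) :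
    momentMap x (S.outer p) = outerMoment (outerRep x) p - block (dualResidue x) p := by
  have h1 : ∀ a, fwd x (.leg none a) (S.outer p) = 0 := fun a =>
    fwd_eq_zero x fun h => by simpa using h.1
  have h2 : ∀ a, fwd x (S.outer p) (.leg none a) = 0 := fun a =>
    fwd_eq_zero x fun h => by simpa using h.1
  have h3 : block (dualResidue x) p =
      bwd x (S.outer p) .centre * fwd x (S.outer p) .centre := by
    rw [block]
    split_ifs with h
    · rfl
    · rw [fwd_eq_zero x (by exact h), Matrix.mul_zero]
  rw [momentMap_eq, sum_vertex, sum_vertex, Fintype.sum_option, Fintype.sum_option, outerMoment, h3,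
    Fintype.sum_sigma, Fintype.sum_sigma, fwd_eq_zero x (not_isArrow_centre _)]
  simp only [h1, h2, Matrix.zero_mul, Matrix.mul_zero, Finset.sum_const_zero, zero_add, outerRep]
  abel

/-! ### The last leg as a chain of nodes indexed by natural numbers. -/

variable (S) in
/-- The nodes of the last leg, starting with the centre. -/
def node : ℕ → S.Vertex
  | 0 => .centre
  -- Beyond the tip the value is the centre. No arrow leaves the centre, so the maps from this extra
  -- node vanish and formulas at the tip need no separate case.
  | j + 1 => if h : j < S.len none then .leg none ⟨j, h⟩ else .centre

theorem node_succ {j : ℕ} (h : j < S.len none) : S.node (j + 1) = .leg none ⟨j, h⟩ := dif_pos h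

theorem depth_node {j : ℕ} (h : j ≤ S.len none) : (S.node j).depth = j := by
  cases j with
  | zero => rfl
  | succ j => rw [node_succ h]; rfl

theorem node_succ_isArrow {j : ℕ} (h : j < S.len none) : IsArrow (S.node (j + 1)) (S.node j) := by
  rw [node_succ h]
  cases j with
  | zero => rfl
  | succ j => rw [node_succ (by omega)]; exact ⟨rfl, rfl⟩

theorem eq_node_of_isArrow {j : ℕ} (h : j < S.len none) {v : S.Vertex}
    (hv : IsArrow v (S.node (j + 1))) : v = S.node (j + 2) := by
  rw [node_succ h] at hv
  rcases v with _ | ⟨i, a⟩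
  · exact absurd hv (not_isArrow_centre _)
  · obtain ⟨rfl, h2⟩ := hv
    simp only at h2
    have := a.2
    rw [node_succ (by omega)]
    congr 1
    exact Fin.ext h2

theorem eq_node_of_isArrow' {j : ℕ} (h : j < S.len none) {v : S.Vertex}
    (hv : IsArrow (S.node (j + 1)) v) : v = S.node j := by
  rw [node_succ h] at hv
  rcases v with _ | ⟨i, a⟩
  · have : j = 0 := hv
    subst this
    rfl
  · obtain ⟨rfl, h2⟩ := hv
    simp only at h2
    subst h2
    rw [node_succ (by omega)]

theorem momentMap_node (x : RepSpace S.dim) {j : ℕ} (h : j < S.len none) :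
    momentMap x (S.node (j + 1)) =
      fwd x (S.node (j + 2)) (S.node (j + 1)) * bwd x (S.node (j + 2)) (S.node (j + 1)) -
      bwd x (S.node (j + 1)) (S.node j) * fwd x (S.node (j + 1)) (S.node j) := by
  rw [momentMap_eq]
  congr 1
  · refine Finset.sum_eq_single _ (fun v _ hv => ?_) (fun h => absurd (Finset.mem_univ _) h)
    rw [fwd_eq_zero x fun h' => hv (eq_node_of_isArrow h h'), Matrix.zero_mul]
  · refine Finset.sum_eq_single _ (fun v _ hv => ?_) (fun h => absurd (Finset.mem_univ _) h)
    rw [fwd_eq_zero x fun h' => hv (eq_node_of_isArrow' h h'), Matrix.mul_zero]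

theorem sum_leg_eq_single {A : Type} [AddCommMonoid A] (f : S.Vertex → A)
    (hf : ∀ v, ¬ IsArrow v .centre → f v = 0) :
    ∑ j, f (.leg none j) = f (S.node 1) := by
  by_cases h : 0 < S.len none
  · rw [node_succ h]
    refine Finset.sum_eq_single _ (fun v _ hv => hf _ fun h' => hv (Fin.ext h'))
      (fun h => absurd (Finset.mem_univ _) h)
  · rw [node, dif_neg h, hf _ (not_isArrow_centre _)]
    exact Finset.sum_eq_zero fun j _ => absurd j.2 (by omega)

theorem momentMap_centre (x : RepSpace S.dim) :
    momentMap x .centre = toCentre x * fromCentre x +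
      fwd x (S.node 1) .centre * bwd x (S.node 1) .centre := by
  have h1 : ∑ j : S.Vertex, bwd x .centre j * fwd x .centre j = 0 :=
    Finset.sum_eq_zero fun j _ => by rw [fwd_eq_zero x (not_isArrow_centre _), Matrix.mul_zero]
  have h2 : toCentre x * fromCentre x =
      ∑ p : S.OuterNode, fwd x (S.outer p) .centre * bwd x (S.outer p) .centre := by
    ext a b
    rw [Matrix.sum_apply, Matrix.mul_apply, Fintype.sum_sigma]
    rw [← Finset.sum_filter_of_ne (p := fun p : S.OuterNode => p.2.val = 0),
      Finset.sum_subtype _ (p := fun p : S.OuterNode => p.2.val = 0) (by simp)]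
    · rfl
    · intro p _ hp
      by_contra h
      exact hp (by rw [fwd_eq_zero x (by exact h), Matrix.zero_mul, Matrix.zero_apply])
  rw [momentMap_eq, h1, sub_zero, sum_vertex, Fintype.sum_option, h2, Fintype.sum_sigma,
    fwd_eq_zero x (not_isArrow_centre _), Matrix.zero_mul, zero_add, add_comm,
    sum_leg_eq_single (fun v => fwd x v .centre * bwd x v .centre)
      fun v hv => by rw [fwd_eq_zero x hv, Matrix.zero_mul]]

/-! ### Parameters and eigenvalues along a leg. -/

theorem legEigenvalue_zero (lam : S.Vertex → ℂ) (i : Option (Fin k)) :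
    S.legEigenvalue lam i 0 = 0 := by
  simp [legEigenvalue]

theorem legEigenvalue_sub_succ (lam : S.Vertex → ℂ) (i : Option (Fin k)) {j : ℕ}
    (h : j < S.len i) :
    S.legEigenvalue lam i j - S.legEigenvalue lam i (j + 1) = lam (.leg i ⟨j, h⟩) := by
  rw [legEigenvalue, legEigenvalue, neg_sub_neg, ← Finset.sum_sub_distrib,
    Finset.sum_eq_single ⟨j, h⟩]
  · simp
  · intro a _ ha
    have : a.val ≠ j := fun h' => ha (Fin.ext h')
    rcases lt_or_gt_of_ne this with h1 | h1
    · rw [if_pos (by omega), if_pos h1, sub_self]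
    · rw [if_neg (by omega), if_neg (by omega), sub_self]
  · exact fun h => absurd (Finset.mem_univ _) h

theorem IsFull.dim_node (hS : S.IsFull) {j : ℕ} (h : j ≤ S.len none) :
    S.dim (S.node j) + j = S.len none + 1 := by
  cases j with
  | zero => exact hS.len.symm
  | succ j => rw [node_succ h, hS.len]; exact hS.dim ⟨j, h⟩

end StarData

namespace StarData

variable {k : ℕ} {S : StarData (Option (Fin k))}

/-! ## Residues at the centre and rigidity of the last leg -/

theorem fullLeg_moment {lam : S.Vertex → ℂ} {x : RepSpace S.dim}
    (hx : x ∈ momentFibre S.dim lam) (j : ℕ) (hj : j < S.len none) :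
    fwd x (S.node (j + 1 + 1)) (S.node (j + 1)) * bwd x (S.node (j + 1 + 1)) (S.node (j + 1)) -
      bwd x (S.node (j + 1)) (S.node j) * fwd x (S.node (j + 1)) (S.node j) =
      Matrix.scalar _ (S.legEigenvalue lam none j - S.legEigenvalue lam none (j + 1)) := by
  rw [← momentMap_node x hj, hx, legEigenvalue_sub_succ lam none hj, node_succ hj]

theorem IsFull.charpoly_residue (hS : S.IsFull) {lam : S.Vertex → ℂ} {x : RepSpace S.dim}
    (hx : x ∈ momentFibre S.dim lam) :
    (fwd x (S.node 1) (S.node 0) * bwd x (S.node 1) (S.node 0)).charpoly =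
      ∏ t : Fin (S.dim (S.node 0)), (X - C (S.legEigenvalue lam none t)) := by
  have h := fullLeg_charpoly (fun j => S.dim (S.node j))
    (fun j => fwd x (S.node (j + 1)) (S.node j)) (fun j => bwd x (S.node (j + 1)) (S.node j))
    (S.legEigenvalue lam none) (S.len none) (fun j hj => hS.dim_node hj) (fullLeg_moment hx) (by
      have : S.node (S.len none + 1) = .centre := dif_neg (lt_irrefl _)
      rw [fwd_eq_zero x (by rw [this]; exact not_isArrow_centre _), Matrix.zero_mul])
    (S.len none) 0 (zero_add _)
  rw [h, hS.len, Finset.prod_range]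
  simp only [zero_add, legEigenvalue_zero, sub_zero]
  rfl

/-- The residue has simple spectrum, so the rank counts the eigenvalues not killed by the
polynomial. Only the first j are killed, and on a full leg the number left is the dimension of node
j. -/
theorem IsFull.rank_residue (hS : S.IsFull) {lam : S.Vertex → ℂ}
    (hinj : Function.Injective fun t : Fin S.centralDim => S.legEigenvalue lam none t)
    {x : RepSpace S.dim} (hx : x ∈ momentFibre S.dim lam) (j : ℕ) (hj : j ≤ S.len none) :
    (aeval (fwd x (S.node 1) (S.node 0) * bwd x (S.node 1) (S.node 0))
      (∏ t ∈ Finset.range j, (X - C (S.legEigenvalue lam none t)))).rank = S.dim (S.node j) := by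
  have h0 := Matrix.rank_aeval_of_charpoly (n := S.dim (S.node 0)) _
    (fun t => S.legEigenvalue lam none t) hinj (hS.charpoly_residue hx)
    (∏ t ∈ Finset.range j, (X - C (S.legEigenvalue lam none t)))
  rw [h0]
  have h1 : ∀ t : Fin (S.dim (S.node 0)), (∏ t ∈ Finset.range j,
      (X - C (S.legEigenvalue lam none t))).eval (S.legEigenvalue lam none t) ≠ 0 ↔ ¬ t.val < j := by
    intro t
    rw [Polynomial.eval_prod, Finset.prod_ne_zero_iff, not_lt]
    have hd := hS.dim_node (Nat.zero_le (S.len none))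
    constructor
    · intro h
      by_contra h'
      exact h t.val (Finset.mem_range.mpr (not_le.mp h')) (by simp)
    · intro h s hs
      have hs' := Finset.mem_range.mp hs
      simp only [eval_sub, eval_X, eval_C, sub_ne_zero]
      intro he
      have := congrArg Fin.val (@hinj t ⟨s, lt_of_lt_of_le hs' (h.trans t.2.le)⟩ he)
      simp only at this
      omega
  have hd := hS.dim_node hj
  have hd0 : S.dim (S.node 0) = S.len none + 1 := hS.dim_node (Nat.zero_le (S.len none))
  rw [Fintype.card_congr (Equiv.subtypeEquivRight h1), Fintype.card_subtype_compl,
    Fintype.card_fin, Fintype.card_subtype]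
  rw [show (Finset.univ.filter fun t : Fin (S.dim (S.node 0)) => t.val < j).card = j by
    rw [Fin.card_filter_val_lt, min_eq_right (by omega)]]
  omega

theorem node_injective {i j : ℕ} (hi : i ≤ S.len none) (hj : j ≤ S.len none)
    (h : S.node i = S.node j) : i = j := by
  rw [← depth_node hi, ← depth_node hj, h]

/-- Two points of the fibre of the moment map which agree outside the last leg are in the same
orbit. -/
theorem IsFull.exists_gaugeAct_eq (hS : S.IsFull) {lam : S.Vertex → ℂ}
    (hinj : Function.Injective fun t : Fin S.centralDim => S.legEigenvalue lam none t)
    {x y : RepSpace S.dim} (hx : x ∈ momentFibre S.dim lam) (hy : y ∈ momentFibre S.dim lam)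
    (hR : outerRep x = outerRep y) (hP : toCentre x = toCentre y)
    (hQ : fromCentre x = fromCentre y) : ∃ g : GaugeGroup S.dim, y = gaugeAct g x := by
  -- The moment equation at the centre expresses the residue of the last leg through P and Q, so the
  -- two residues agree and rigidity applies.
  have h0 : fwd x (S.node 1) (S.node 0) * bwd x (S.node 1) (S.node 0) =
      fwd y (S.node 1) (S.node 0) * bwd y (S.node 1) (S.node 0) := by
    have h1 := (momentMap_centre x).symm.trans (hx _)
    have h2 := (momentMap_centre y).symm.trans (hy _)
    rw [← h2, hP, hQ] at h1
    exact add_left_cancel (G := Matrix (Fin (S.dim .centre)) (Fin (S.dim .centre)) ℂ) h1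
  obtain ⟨h, h00, hh⟩ := fullLeg_rigid (fun j => S.dim (S.node j))
    (fun j => fwd x (S.node (j + 1)) (S.node j)) (fun j => fwd y (S.node (j + 1)) (S.node j))
    (fun j => bwd x (S.node (j + 1)) (S.node j)) (fun j => bwd y (S.node (j + 1)) (S.node j))
    (S.legEigenvalue lam none) (S.len none) (legEigenvalue_zero lam none)
    (fullLeg_moment hx) (fullLeg_moment hy) (hS.rank_residue hinj hx) h0
  classical
  have hg : ∃ g : GaugeGroup S.dim, (∀ j ≤ S.len none, g (S.node j) = h j) ∧
      ∀ p, g (S.outer p) = 1 := by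
    -- The base changes of the chain are transported to the actual nodes and extended by 1.
    -- Injectivity of `node` up to the tip makes the chosen index the expected one.
    refine ⟨fun v => if hv : ∃ j ≤ S.len none, S.node j = v then
      hv.choose_spec.2 ▸ h hv.choose else 1, fun j hj => ?_, fun p => ?_⟩
    · have hv : ∃ j' ≤ S.len none, S.node j' = S.node j := ⟨j, hj, rfl⟩
      simp only [dif_pos hv]
      have h1 := node_injective hv.choose_spec.1 hj hv.choose_spec.2
      have h2 : ∀ (j' : ℕ) (e : j' = j) (e' : S.node j' = S.node j),
          (e' ▸ h j' : GL (Fin (S.dim (S.node j))) ℂ) = h j := by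
        rintro j' rfl _
        rfl
      exact h2 _ h1 _
    · refine dif_neg ?_
      rintro ⟨j, hj, h⟩
      rcases j with _ | j
      · cases h
      · rw [node_succ hj] at h
        cases h
  obtain ⟨g, hgn, hgo⟩ := hg
  have hinv : ∀ v, (g v)⁻¹.val * (g v).val = 1 := fun v => by simp
  have hinv' : ∀ v, (g v).val * (g v)⁻¹.val = 1 := fun v => by simp
  have hgc : g .centre = 1 := (hgn 0 (Nat.zero_le _)).trans h00
  refine ⟨g, ?_⟩
  have main : ∀ v w, IsArrow v w → fwd y v w = (g w).val * fwd x v w * (g v)⁻¹.val ∧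
      bwd y v w = (g v).val * bwd x v w * (g w)⁻¹.val := by
    intro v w hvw
    rcases v with _ | ⟨_ | i, a⟩
    · exact absurd hvw (not_isArrow_centre _)
    · obtain ⟨j, hj⟩ := a
      rw [← node_succ hj] at hvw ⊢
      obtain rfl := eq_node_of_isArrow' hj hvw
      obtain ⟨h1, h2⟩ := hh j hj
      rw [hgn _ hj, hgn j hj.le]
      constructor
      · rw [← h2, Matrix.mul_assoc, ← Units.val_mul, mul_inv_cancel, Units.val_one, Matrix.mul_one]
      · rw [h1, Matrix.mul_assoc, ← Units.val_mul, mul_inv_cancel, Units.val_one, Matrix.mul_one]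
    · have hgo' : g (.leg (some i) a) = 1 := hgo ⟨i, a⟩
      rcases w with _ | ⟨i', b⟩
      · have ha : a.val = 0 := hvw
        rw [hgc, hgo']
        constructor
        · have : fwd x (.leg (some i) a) .centre = fwd y (.leg (some i) a) .centre := by
            ext q b
            exact congrFun (congrFun hP q) ⟨⟨⟨i, a⟩, ha⟩, b⟩
          simp [this]
        · have : bwd x (.leg (some i) a) .centre = bwd y (.leg (some i) a) .centre := by
            ext b q
            exact congrFun (congrFun hQ ⟨⟨⟨i, a⟩, ha⟩, b⟩) q
          simp [this]
      · obtain ⟨rfl, -⟩ := hvw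
        have hgo'' : g (.leg (some i) b) = 1 := hgo ⟨i, b⟩
        rw [hgo', hgo'']
        have h1 := congrFun (congrFun hR ⟨i, a⟩) ⟨i, b⟩
        have h2 := congrArg Prod.fst h1
        have h3 := congrArg Prod.snd h1
        simp only [outerRep] at h2 h3
        simp [← h2, ← h3]
  exact rep_ext (fun v w e => by rw [fwd_gaugeAct, (main v w e).1])
    (fun v w e => by rw [bwd_gaugeAct, (main v w e).2])

/-! ### Gauge action on the dual residue and on the outer maps. -/

/-- The base change of the sum of the spaces at the neighbours of the centre. -/
def outerGauge (g : GaugeGroup S.dim) : Matrix S.OuterIndex S.OuterIndex ℂ :=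
  Matrix.blockDiagonal' fun p => (g (S.outer p.1)).val

theorem outerGauge_mul_inv (g : GaugeGroup S.dim) : outerGauge g * outerGauge g⁻¹ = 1 := by
  rw [outerGauge, outerGauge, ← Matrix.blockDiagonal'_mul, ← Matrix.blockDiagonal'_one]
  congr 1
  funext p
  rw [← Units.val_mul]
  simp

theorem toCentre_gaugeAct (g : GaugeGroup S.dim) (x : RepSpace S.dim) :
    toCentre (gaugeAct g x) = (g .centre).val * toCentre x * outerGauge g⁻¹ := by
  ext q ⟨p, b⟩
  have : toCentre (gaugeAct g x) q ⟨p, b⟩ =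
    ((g .centre).val * fwd x (S.outer p.1) .centre * (g (S.outer p.1))⁻¹.val) q b := by
    rw [← fwd_gaugeAct]; rfl
  rw [this, Matrix.mul_apply, Matrix.mul_apply, Fintype.sum_sigma, Finset.sum_eq_single p]
  · refine Finset.sum_congr rfl fun a _ => ?_
    rw [outerGauge, Matrix.blockDiagonal'_apply_eq]
    rfl
  · intro p' _ hp'
    exact Finset.sum_eq_zero fun a _ => by
      rw [outerGauge, Matrix.blockDiagonal'_apply_ne _ _ _ hp', mul_zero]
  · exact fun h => absurd (Finset.mem_univ _) h

theorem fromCentre_gaugeAct (g : GaugeGroup S.dim) (x : RepSpace S.dim) :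
    fromCentre (gaugeAct g x) = outerGauge g * fromCentre x * (g .centre)⁻¹.val := by
  ext ⟨p, b⟩ q
  have : fromCentre (gaugeAct g x) ⟨p, b⟩ q =
    ((g (S.outer p.1)).val * (bwd x (S.outer p.1) .centre * (g .centre)⁻¹.val)) b q := by
    rw [← Matrix.mul_assoc, ← bwd_gaugeAct]; rfl
  rw [this, Matrix.mul_assoc, Matrix.mul_apply, Matrix.mul_apply, Fintype.sum_sigma,
    Finset.sum_eq_single p]
  · refine Finset.sum_congr rfl fun a _ => ?_
    rw [outerGauge, Matrix.blockDiagonal'_apply_eq]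
    rfl
  · intro p' _ hp'
    exact Finset.sum_eq_zero fun a _ => by
      rw [outerGauge, Matrix.blockDiagonal'_apply_ne _ _ _ hp'.symm, zero_mul]
  · exact fun h => absurd (Finset.mem_univ _) h

theorem dualResidue_gaugeAct (g : GaugeGroup S.dim) (x : RepSpace S.dim) :
    dualResidue (gaugeAct g x) = outerGauge g * dualResidue x * outerGauge g⁻¹ := by
  rw [dualResidue, dualResidue, toCentre_gaugeAct, fromCentre_gaugeAct]
  have : (g .centre)⁻¹.val * (g .centre).val = 1 := by simp
  simp only [Matrix.mul_assoc]
  rw [← Matrix.mul_assoc (g .centre)⁻¹.val, this, Matrix.one_mul]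

theorem outerRep_gaugeAct (g : GaugeGroup S.dim) (x : RepSpace S.dim) :
    outerRep (gaugeAct g x) = fun p q =>
      ((g (S.outer q)).val * (outerRep x p q).1 * (g (S.outer p))⁻¹.val,
        (g (S.outer p)).val * (outerRep x p q).2 * (g (S.outer q))⁻¹.val) := by
  funext p q
  exact Prod.ext (fwd_gaugeAct g x _ _) (bwd_gaugeAct g x _ _)

/-- The element of the gauge group which is `u` at the centre and trivial elsewhere. -/
def centreGauge (u : GL (Fin (S.dim .centre)) ℂ) : GaugeGroup S.dim
  | .centre => u
  | .leg _ _ => 1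

theorem outerGauge_centreGauge (u : GL (Fin (S.dim .centre)) ℂ) :
    outerGauge (centreGauge u) = 1 := by
  rw [outerGauge, ← Matrix.blockDiagonal'_one]
  rfl

theorem outerGauge_centreGauge_inv (u : GL (Fin (S.dim .centre)) ℂ) :
    outerGauge (centreGauge u)⁻¹ = 1 := by
  have := outerGauge_mul_inv (centreGauge u)
  rwa [outerGauge_centreGauge, Matrix.one_mul] at this

/-- The base change u at the centre makes the two points agree outside the last leg, and rigidity of
that leg supplies the rest of the gauge transformation. -/
theorem IsFull.invariant_eq_of_centre (hS : S.IsFull) {lam : S.Vertex → ℂ}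
    (hinj : Function.Injective fun t : Fin S.centralDim => S.legEigenvalue lam none t)
    {f : momentFibre S.dim lam → ℂ} (hf : f ∈ gaugeInvariants S.dim lam)
    (x y : momentFibre S.dim lam) (u : GL (Fin (S.dim .centre)) ℂ)
    (hR : outerRep y.1 = outerRep x.1) (hP : toCentre y.1 = u.val * toCentre x.1)
    (hQ : fromCentre y.1 = fromCentre x.1 * u⁻¹.val) : f y = f x := by
  have hx' := gaugeAct_mem_momentFibre (centreGauge u) x.2
  obtain ⟨g, hg⟩ := hS.exists_gaugeAct_eq hinj hx' y.2
    (by rw [hR, outerRep_gaugeAct]; funext p q; simp [centreGauge])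
    (by rw [hP, toCentre_gaugeAct, outerGauge_centreGauge_inv, Matrix.mul_one]; rfl)
    (by rw [hQ, fromCentre_gaugeAct, outerGauge_centreGauge, Matrix.one_mul]; rfl)
  exact (hf g ⟨_, hx'⟩ y hg).trans (hf (centreGauge u) x ⟨_, hx'⟩ rfl)

end StarData

/-! ## Standard representations of the last leg -/

/-- The inclusion of the span of all basis vectors but the first. -/
def shiftIn (m n : ℕ) : Matrix (Fin m) (Fin n) ℂ :=
  Matrix.of fun p q => if p.val = q.val + 1 then 1 else 0

/-- The projection to the span of all basis vectors but the first, followed by the diagonal matrix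
with entries `e`. -/
def shiftOut (n m : ℕ) (e : ℕ → ℂ) : Matrix (Fin n) (Fin m) ℂ :=
  Matrix.of fun q p => if p.val = q.val + 1 then e q.val else 0

theorem shiftIn_mul_shiftOut {m n : ℕ} (h : m = n + 1) (e E : ℕ → ℂ) (h0 : E 0 = 0)
    (hE : ∀ q, E (q + 1) = e q) :
    shiftIn m n * shiftOut n m e = Matrix.diagonal fun p => E p.val := by
  subst h
  ext p p'
  rw [Matrix.mul_apply, Matrix.diagonal_apply]
  simp only [shiftIn, shiftOut, Matrix.of_apply]
  refine Fin.cases ?_ (fun p => ?_) p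
  · rw [Finset.sum_eq_zero]
    · simp [h0]
    · intro q _
      simp
  · rw [Finset.sum_eq_single p]
    · simp [hE, Fin.ext_iff, eq_comm]
    · intro q _ hq
      have : p.val ≠ q.val := fun h => hq (Fin.ext h.symm)
      simp [this]
    · simp

theorem shiftOut_mul_shiftIn {m n : ℕ} (h : m = n + 1) (e : ℕ → ℂ) :
    shiftOut n m e * shiftIn m n = Matrix.diagonal fun q => e q.val := by
  subst h
  ext q q'
  rw [Matrix.mul_apply, Matrix.diagonal_apply, Finset.sum_eq_single q.succ]
  · simp [shiftIn, shiftOut, Fin.ext_iff]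
  · intro p _ hp
    have : p.val ≠ q.val + 1 := fun h => hp (Fin.ext h)
    simp [shiftOut, this]
  · simp

namespace StarData

variable {k : ℕ} {S : StarData (Option (Fin k))}

/-- The maps `φ_e` of the representation with standard last leg and otherwise given maps. -/
def assembleFwd (P : Matrix (Fin (S.dim .centre)) S.OuterIndex ℂ) (R : S.OuterRep) :
    ∀ v w : S.Vertex, Matrix (Fin (S.dim w)) (Fin (S.dim v)) ℂ
  | .leg none _, _ => shiftIn _ _
  | .leg (some i) a, .centre =>
      if h : a.val = 0 then Matrix.of fun q b => P q ⟨⟨⟨i, a⟩, h⟩, b⟩ else 0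
  | .leg (some i) a, .leg (some i') b => (R ⟨i, a⟩ ⟨i', b⟩).1
  | .leg (some _) _, .leg none _ => 0
  | .centre, _ => 0

/-- The maps `φ_{e*}` of the representation with standard last leg and otherwise given maps. -/
def assembleBwd (ξ : ℕ → ℂ) (Q : Matrix S.OuterIndex (Fin (S.dim .centre)) ℂ) (R : S.OuterRep) :
    ∀ v w : S.Vertex, Matrix (Fin (S.dim v)) (Fin (S.dim w)) ℂ
  -- In the chain numbering the source is node a + 1 and w is node a, so this is ξ (j + 1 + q) - ξ j
  -- with j the depth of w. It makes every residue diagonal with entries ξ (j + p) - ξ j, the first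
  -- being zero.
  | .leg none a, w => shiftOut _ _ fun q => ξ (a.val + 1 + q) - ξ w.depth
  | .leg (some i) a, .centre =>
      if h : a.val = 0 then Matrix.of fun b q => Q ⟨⟨⟨i, a⟩, h⟩, b⟩ q else 0
  | .leg (some i) a, .leg (some i') b => (R ⟨i, a⟩ ⟨i', b⟩).2
  | .leg (some _) _, .leg none _ => 0
  | .centre, _ => 0

/-- The representation with standard last leg and otherwise given maps. -/
def assemble (ξ : ℕ → ℂ) (P : Matrix (Fin (S.dim .centre)) S.OuterIndex ℂ)
    (Q : Matrix S.OuterIndex (Fin (S.dim .centre)) ℂ) (R : S.OuterRep) : RepSpace S.dim :=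
  fun v w _ => (assembleFwd P R v w, assembleBwd ξ Q R v w)

variable (ξ : ℕ → ℂ) (P : Matrix (Fin (S.dim .centre)) S.OuterIndex ℂ)
    (Q : Matrix S.OuterIndex (Fin (S.dim .centre)) ℂ) (R : S.OuterRep)

theorem fwd_assemble {v w : S.Vertex} (h : IsArrow v w) :
    fwd (assemble ξ P Q R) v w = assembleFwd P R v w := fwd_arrow _ ⟨h⟩

theorem bwd_assemble {v w : S.Vertex} (h : IsArrow v w) :
    bwd (assemble ξ P Q R) v w = assembleBwd ξ Q R v w := bwd_arrow _ ⟨h⟩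

theorem toCentre_assemble : toCentre (assemble ξ P Q R) = P := by
  ext q ⟨⟨p, h⟩, b⟩
  have := fwd_assemble ξ P Q R (v := S.outer p) (w := .centre) h
  rw [assembleFwd, dif_pos h] at this
  exact congrFun (congrFun this q) b

theorem fromCentre_assemble : fromCentre (assemble ξ P Q R) = Q := by
  ext ⟨⟨p, h⟩, b⟩ q
  have := bwd_assemble ξ P Q R (v := S.outer p) (w := .centre) h
  rw [assembleBwd, dif_pos h] at this
  exact congrFun (congrFun this b) q

theorem outerRep_assemble (hR : ∀ p q, ¬ IsArrow (S.outer p) (S.outer q) → R p q = 0) :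
    outerRep (assemble ξ P Q R) = R := by
  funext p q
  by_cases h : IsArrow (S.outer p) (S.outer q)
  · exact Prod.ext (fwd_assemble ξ P Q R h) (bwd_assemble ξ P Q R h)
  · rw [hR p q h, outerRep_eq_zero _ h]

theorem fwd_assemble_node {j : ℕ} (h : j < S.len none) :
    fwd (assemble ξ P Q R) (S.node (j + 1)) (S.node j) = shiftIn _ _ := by
  rw [fwd_assemble _ _ _ _ (node_succ_isArrow h), node_succ h]
  rfl

theorem bwd_assemble_node {j : ℕ} (h : j < S.len none) :
    bwd (assemble ξ P Q R) (S.node (j + 1)) (S.node j) =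
      shiftOut _ _ fun q => ξ (j + 1 + q) - ξ j := by
  rw [bwd_assemble _ _ _ _ (node_succ_isArrow h), node_succ h]
  change shiftOut _ _ (fun q => ξ (j + 1 + q) - ξ (S.node j).depth) = _
  rw [depth_node h.le]

theorem IsFull.residue_assemble (hS : S.IsFull) {j : ℕ} (h : j ≤ S.len none) :
    fwd (assemble ξ P Q R) (S.node (j + 1)) (S.node j) *
      bwd (assemble ξ P Q R) (S.node (j + 1)) (S.node j) =
      Matrix.diagonal fun p => ξ (j + p.val) - ξ j := by
  have h1 := hS.dim_node h
  rcases h.lt_or_eq with h' | rfl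
  · rw [fwd_assemble_node ξ P Q R h', bwd_assemble_node ξ P Q R h']
    have h2 : S.dim (S.node (j + 1)) + (j + 1) = _ := hS.dim_node h'
    refine shiftIn_mul_shiftOut (by omega) _ (fun p => ξ (j + p) - ξ j) (by simp) fun q => ?_
    simp only [add_assoc, add_comm 1]
  -- At the tip the space is one-dimensional: the only index is p = 0, for which the diagonal entry
  -- vanishes, as does the product on the left.
  · have : S.node (S.len none + 1) = .centre := dif_neg (lt_irrefl _)
    rw [fwd_eq_zero _ (by rw [this]; exact not_isArrow_centre _), Matrix.zero_mul, eq_comm,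
      Matrix.diagonal_eq_zero]
    funext p
    have hp : p.val = 0 := by have := p.2; omega
    simp [hp]

/-- Along the last leg both products are diagonal and differ by a constant. At the centre, the
hypothesis on PQ is the moment equation for this standard diagonal residue. -/
theorem IsFull.assemble_mem (hS : S.IsFull) (lam : S.Vertex → ℂ)
    (hc : P * Q = Matrix.diagonal fun t => lam .centre - S.legEigenvalue lam none t.val)
    (hR : ∀ p q, ¬ IsArrow (S.outer p) (S.outer q) → R p q = 0)
    (hM : ∀ p, outerMoment R p - block (Q * P) p = Matrix.scalar _ (lam (S.outer p))) :
    assemble (S.legEigenvalue lam none) P Q R ∈ momentFibre S.dim lam := by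
  have hnode : ∀ j, j < S.len none →
      momentMap (assemble (S.legEigenvalue lam none) P Q R) (S.node (j + 1)) =
        Matrix.scalar _ (lam (S.node (j + 1))) := by
    intro j hj
    have h1 : S.dim (S.node (j + 1)) + (j + 1) = _ := hS.dim_node hj
    have h2 := hS.dim_node hj.le
    rw [momentMap_node _ hj, hS.residue_assemble _ P Q R hj, fwd_assemble_node _ P Q R hj,
      bwd_assemble_node _ P Q R hj, shiftOut_mul_shiftIn (by omega), Matrix.diagonal_sub,
      Matrix.scalar_apply]
    congr 1
    funext p
    have h3 := legEigenvalue_sub_succ lam none hj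
    rw [← node_succ hj] at h3
    rw [← h3]
    ring
  rintro (_ | ⟨_ | i, a⟩)
  · have h := hS.residue_assemble (S.legEigenvalue lam none) P Q R (Nat.zero_le _)
    have h' : fwd (assemble (S.legEigenvalue lam none) P Q R) (S.node 1) .centre *
        bwd (assemble (S.legEigenvalue lam none) P Q R) (S.node 1) .centre =
        Matrix.diagonal fun p : Fin (S.dim .centre) => S.legEigenvalue lam none (0 + p.val) -
          S.legEigenvalue lam none 0 := h
    rw [momentMap_centre, toCentre_assemble, fromCentre_assemble, hc, h', Matrix.diagonal_add, Matrix.scalar_apply]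
    congr 1
    funext p
    simp [legEigenvalue_zero]
  · have h := hnode a.val a.2
    rwa [node_succ a.2] at h
  · have h := momentMap_outer (assemble (S.legEigenvalue lam none) P Q R) ⟨i, a⟩
    rw [outerRep_assemble _ P Q R hR, dualResidue, toCentre_assemble, fromCentre_assemble, hM] at h
    exact h

/-! ## The spectrum of the dual residue -/

/-- An enumeration of the eigenvalues of the dual residue of the points of `μ⁻¹(lam)`, for a
representation space with full last leg. -/
structure SpectralData (S : StarData (Option (Fin k))) (lam : S.Vertex → ℂ) (K : Type)
    [Fintype K] where
  /-- The eigenvalues. -/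
  eig : K → ℂ
  /-- The eigenvalues of the residue at the centre as eigenvalues of the dual residue. -/
  emb : Fin (S.dim .centre) → K
  full : S.IsFull
  eig_inj : Function.Injective eig
  emb_inj : Function.Injective emb
  eig_emb : ∀ t, eig (emb t) = lam .centre - S.legEigenvalue lam none t.val
  eig_eq_zero : ∀ k, k ∉ Set.range emb → eig k = 0
  card_eq : Fintype.card S.OuterIndex = Fintype.card K

namespace SpectralData

variable {lam : S.Vertex → ℂ} {K : Type} [Fintype K] (D : SpectralData S lam K)


theorem legEigenvalue_injective (D : SpectralData S lam K) :
    Function.Injective fun t : Fin S.centralDim => S.legEigenvalue lam none t := by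
  intro s t h
  refine D.emb_inj (D.eig_inj ?_)
  exact (D.eig_emb s).trans ((congrArg _ h).trans (D.eig_emb t).symm)

/-- The maps to the centre of the section of the dual residue given by a basis of eigenvectors. -/
def secTo (p : Fin (S.dim .centre) → ℂ) (g' : Matrix K S.OuterIndex ℂ) :
    Matrix (Fin (S.dim .centre)) S.OuterIndex ℂ :=
  Matrix.of fun t s => p t * g' (D.emb t) s

/-- The maps from the centre of the section of the dual residue given by a basis of
eigenvectors. -/
def secFrom (q : Fin (S.dim .centre) → ℂ) (g : Matrix S.OuterIndex K ℂ) :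
    Matrix S.OuterIndex (Fin (S.dim .centre)) ℂ :=
  Matrix.of fun s t => g s (D.emb t) * q t

/-- The section of the dual residue given by a basis of eigenvectors. -/
def sec (p q : Fin (S.dim .centre) → ℂ) (g : Matrix S.OuterIndex K ℂ)
    (g' : Matrix K S.OuterIndex ℂ) (R : S.OuterRep) : RepSpace S.dim :=
  assemble (S.legEigenvalue lam none) (D.secTo p g') (D.secFrom q g) R

theorem outerRep_sec (g : Matrix S.OuterIndex K ℂ) (g' : Matrix K S.OuterIndex ℂ)
    (p q : Fin (S.dim .centre) → ℂ) {R : S.OuterRep}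
    (hR : ∀ p q, ¬ IsArrow (S.outer p) (S.outer q) → R p q = 0) :
    outerRep (D.sec p q g g' R) = R :=
  outerRep_assemble _ _ _ _ hR

/-- The moment equation makes PQ the central parameter minus the residue of the full leg, whose
spectrum is simple. -/
theorem exists_diagonalisation_centre {x : RepSpace S.dim} (hx : x ∈ momentFibre S.dim lam) :
    ∃ u : GL (Fin (S.dim .centre)) ℂ, u.val * (toCentre x * fromCentre x) * u⁻¹.val =
      Matrix.diagonal fun t => D.eig (D.emb t) := by
  have h0 : (fwd x (S.node 1) .centre * bwd x (S.node 1) .centre).charpoly =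
      ∏ t : Fin (S.dim .centre), (X - C (S.legEigenvalue lam none t)) := D.full.charpoly_residue hx
  obtain ⟨g, g', h1, h2, h3⟩ := Matrix.exists_diagonalisation _
    (fun t : Fin (S.dim .centre) => S.legEigenvalue lam none t.val) D.legEigenvalue_injective rfl h0
  refine ⟨⟨g', g, h2, h1⟩, ?_⟩
  change g' * (toCentre x * fromCentre x) * g = _
  have h4 := (momentMap_centre x).symm.trans (hx _)
  rw [eq_sub_of_add_eq h4, Matrix.mul_assoc, Matrix.sub_mul, h3,
    (Matrix.scalar_commute (lam .centre) (fun r => mul_comm _ _) g).eq, ← Matrix.mul_sub,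
    ← Matrix.mul_assoc, h2, Matrix.one_mul, Matrix.scalar_apply, Matrix.diagonal_sub]
  congr 1
  funext t
  rw [D.eig_emb]

variable [DecidableEq K]

/-- PQ and QP have the same characteristic polynomial up to powers of X, and the eigenvalues outside
the image of `emb` are zero, which accounts for exactly the extra powers. -/
theorem charpoly_dualResidue {x : RepSpace S.dim} (hx : x ∈ momentFibre S.dim lam) :
    (dualResidue x).charpoly = ∏ k, (X - C (D.eig k)) := by
  obtain ⟨u, hu⟩ := D.exists_diagonalisation_centre hx
  have h1 : (toCentre x * fromCentre x).charpoly = ∏ t, (X - C (D.eig (D.emb t))) := by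
    rw [← Matrix.charpoly_diagonal, ← hu, Matrix.coe_units_inv, Matrix.charpoly_units_conj]
  have h2 := Matrix.charpoly_mul_comm' (fromCentre x) (toCentre x)
  have h3 : ∏ k, (X - C (D.eig k)) =
      X ^ (Fintype.card K - S.dim .centre) * ∏ t, (X - C (D.eig (D.emb t))) := by
    rw [← Finset.prod_compl_mul_prod (Finset.univ.image D.emb),
      Finset.prod_image (D.emb_inj.injOn)]
    congr 1
    rw [Finset.prod_congr rfl (g := fun _ => X), Finset.prod_const, Finset.card_compl,
      Finset.card_image_of_injective _ D.emb_inj, Finset.card_univ, Fintype.card_fin]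
    intro k hk
    rw [D.eig_eq_zero k (by simpa using hk), C_0, sub_zero]
  have h4 : S.dim .centre ≤ Fintype.card K := by
    simpa using Fintype.card_le_of_injective _ D.emb_inj
  rw [h1, D.card_eq, Fintype.card_fin] at h2
  -- The comparison of PQ with QP carries a power of X on each side, so X to the central dimension
  -- has to be cancelled.
  refine (isRegular_X_pow (S.dim .centre)).left ?_
  change X ^ _ * _ = X ^ _ * _
  rw [dualResidue, h2, h3, ← mul_assoc, ← pow_add, Nat.add_sub_cancel' h4]

theorem exists_diagonalisation {x : RepSpace S.dim} (hx : x ∈ momentFibre S.dim lam) :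
    ∃ (g : Matrix S.OuterIndex K ℂ) (g' : Matrix K S.OuterIndex ℂ), g * g' = 1 ∧ g' * g = 1 ∧
      dualResidue x * g = g * Matrix.diagonal D.eig :=
  Matrix.exists_diagonalisation _ _ D.eig_inj D.card_eq (D.charpoly_dualResidue hx)

theorem secTo_mul_secFrom {g : Matrix S.OuterIndex K ℂ} {g' : Matrix K S.OuterIndex ℂ}
    (h : g' * g = 1) (p q : Fin (S.dim .centre) → ℂ) :
    D.secTo p g' * D.secFrom q g = Matrix.diagonal fun t => p t * q t := by
  ext t t'
  have h1 := congrFun (congrFun h (D.emb t)) (D.emb t')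
  rw [Matrix.mul_apply] at h1 ⊢
  have : ∑ s, D.secTo p g' t s * D.secFrom q g s t' =
      p t * q t' * ∑ s, g' (D.emb t) s * g s (D.emb t') := by
    rw [Finset.mul_sum]
    refine Finset.sum_congr rfl fun s _ => ?_
    simp only [secTo, secFrom, Matrix.of_apply]
    ring
  rw [this, h1, Matrix.one_apply, Matrix.diagonal_apply]
  simp only [D.emb_inj.eq_iff]
  split_ifs with h2
  · rw [h2, mul_one]
  · rw [mul_zero]

theorem secFrom_mul_secTo (g : Matrix S.OuterIndex K ℂ) (g' : Matrix K S.OuterIndex ℂ)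
    {p q : Fin (S.dim .centre) → ℂ} (hpq : ∀ t, p t * q t = D.eig (D.emb t)) :
    D.secFrom q g * D.secTo p g' = g * Matrix.diagonal D.eig * g' := by
  ext s s'
  rw [Matrix.mul_apply, Matrix.mul_apply]
  simp only [Matrix.mul_diagonal]
  refine Fintype.sum_of_injective D.emb D.emb_inj _ _ (fun k hk => ?_) fun t => ?_
  · rw [D.eig_eq_zero k hk, mul_zero, zero_mul]
  · rw [← hpq]
    simp only [secTo, secFrom, Matrix.of_apply]
    ring

theorem sec_mem {g : Matrix S.OuterIndex K ℂ} {g' : Matrix K S.OuterIndex ℂ} (h : g' * g = 1)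
    {p q : Fin (S.dim .centre) → ℂ} (hpq : ∀ t, p t * q t = D.eig (D.emb t)) {R : S.OuterRep}
    (hR : ∀ p q, ¬ IsArrow (S.outer p) (S.outer q) → R p q = 0)
    (hM : ∀ p, outerMoment R p - block (g * Matrix.diagonal D.eig * g') p =
      Matrix.scalar _ (lam (S.outer p))) : D.sec p q g g' R ∈ momentFibre S.dim lam := by
  refine D.full.assemble_mem _ _ _ lam ?_ hR ?_
  · rw [D.secTo_mul_secFrom h]
    simp only [hpq, D.eig_emb]
  · rwa [D.secFrom_mul_secTo g g' hpq]

theorem dualResidue_sec (g : Matrix S.OuterIndex K ℂ) (g' : Matrix K S.OuterIndex ℂ)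
    {p q : Fin (S.dim .centre) → ℂ} (hpq : ∀ t, p t * q t = D.eig (D.emb t)) (R : S.OuterRep) :
    dualResidue (D.sec p q g g' R) = g * Matrix.diagonal D.eig * g' := by
  rw [dualResidue, sec, toCentre_assemble, fromCentre_assemble, D.secFrom_mul_secTo g g' hpq]

end SpectralData

end StarData

/-! ## Invariants are determined by the dual residue -/

/-- Continuity is all that the degeneration argument below needs of regular functions: it passes
values from orbits to limits of orbits. -/
theorem continuous_of_mem_fibreCoordinateRing {V : Type} [Quiver.{0} V] [Fintype V]
    [∀ i j : V, Fintype (i ⟶ j)] {d : V → ℕ} {lam : V → ℂ} {f : momentFibre d lam → ℂ}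
    (hf : f ∈ fibreCoordinateRing d lam) : Continuous f := by
  have h0 : ∀ (i j : V) (e : i ⟶ j), Continuous fun x : momentFibre d lam => x.1 i j e := by
    intro i j e
    exact continuous_pi_iff.mp (continuous_pi_iff.mp (continuous_pi_iff.mp
      continuous_subtype_val i) j) e
  induction hf using Algebra.adjoin_induction with
  | mem f hf =>
    rcases hf with ⟨i, j, e, a, b, rfl⟩ | ⟨i, j, e, a, b, rfl⟩
    · exact (continuous_fst.comp (h0 i j e)).matrix_elem a b
    · exact (continuous_snd.comp (h0 i j e)).matrix_elem a b
  | algebraMap r => exact continuous_const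
  | add f g _ _ hf hg => exact hf.add hg
  | mul f g _ _ hf hg => exact hf.mul hg

theorem eq_of_continuous_of_forall_ne {h : ℂ → ℂ} (hc : Continuous h)
    (h' : ∀ s, s ≠ 0 → h s = h 1) : h 0 = h 1 := by
  have := Continuous.ext_on (dense_compl_singleton (0 : ℂ)) hc (continuous_const (y := h 1)) h'
  exact congrFun this 0

namespace StarData

variable {k : ℕ} {S : StarData (Option (Fin k))}

theorem continuous_assemble (ξ : ℕ → ℂ) {P : ℂ → Matrix (Fin (S.dim .centre)) S.OuterIndex ℂ}
    {Q : ℂ → Matrix S.OuterIndex (Fin (S.dim .centre)) ℂ} (R : S.OuterRep)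
    (hP : Continuous P) (hQ : Continuous Q) : Continuous fun s => assemble ξ (P s) (Q s) R := by
  refine continuous_pi fun v => continuous_pi fun w => continuous_pi fun e => ?_
  refine Continuous.prodMk ?_ ?_
  · rcases v with _ | ⟨_ | i, a⟩
    · exact continuous_const
    · exact continuous_const
    · rcases w with _ | ⟨_ | i', b⟩
      · have ha : a.val = 0 := e.down
        refine continuous_matrix fun q b => ?_
        simp only [assembleFwd, dif_pos ha, Matrix.of_apply]
        exact hP.matrix_elem _ _
      · exact continuous_const
      · exact continuous_const
  · rcases v with _ | ⟨_ | i, a⟩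
    · exact continuous_const
    · exact continuous_const
    · rcases w with _ | ⟨_ | i', b⟩
      · have ha : a.val = 0 := e.down
        refine continuous_matrix fun q b => ?_
        simp only [assembleBwd, dif_pos ha, Matrix.of_apply]
        exact hQ.matrix_elem _ _
      · exact continuous_const
      · exact continuous_const

namespace SpectralData

variable {lam : S.Vertex → ℂ} {K : Type} [Fintype K] (D : SpectralData S lam K)

theorem continuous_sec {p q : ℂ → Fin (S.dim .centre) → ℂ} (hp : Continuous p) (hq : Continuous q)
    (g : Matrix S.OuterIndex K ℂ) (g' : Matrix K S.OuterIndex ℂ) (R : S.OuterRep) :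
    Continuous fun s => D.sec (p s) (q s) g g' R := by
  refine continuous_assemble _ _ (continuous_matrix fun t s => ?_) (continuous_matrix fun s t => ?_)
  · exact ((continuous_apply t).comp hp).mul continuous_const
  · exact continuous_const.mul ((continuous_apply t).comp hq)

/-- The diagonal torus at the centre scales p by u and q by the inverse of u. -/
theorem invariant_sec_smul {f : momentFibre S.dim lam → ℂ} (hf : f ∈ gaugeInvariants S.dim lam)
    {g : Matrix S.OuterIndex K ℂ} {g' : Matrix K S.OuterIndex ℂ} {R : S.OuterRep}
    (hR : ∀ p q, ¬ IsArrow (S.outer p) (S.outer q) → R p q = 0)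
    {p q p' q' : Fin (S.dim .centre) → ℂ}
    (hpq : D.sec p q g g' R ∈ momentFibre S.dim lam)
    (hpq' : D.sec p' q' g g' R ∈ momentFibre S.dim lam)
    (u : Fin (S.dim .centre) → ℂ) (hu : ∀ t, u t ≠ 0) (h1 : ∀ t, p' t = u t * p t)
    (h2 : ∀ t, u t * q' t = q t) : f ⟨_, hpq'⟩ = f ⟨_, hpq⟩ := by
  have e1 : Matrix.diagonal u * Matrix.diagonal (fun t => (u t)⁻¹) = 1 := by
    rw [Matrix.diagonal_mul_diagonal, ← Matrix.diagonal_one]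
    congr 1
    funext t
    exact mul_inv_cancel₀ (hu t)
  refine D.full.invariant_eq_of_centre D.legEigenvalue_injective hf ⟨_, hpq⟩ ⟨_, hpq'⟩
    ⟨Matrix.diagonal u, Matrix.diagonal fun t => (u t)⁻¹, e1, mul_eq_one_comm.mp e1⟩ ?_ ?_ ?_
  · rw [D.outerRep_sec _ _ _ _ hR, D.outerRep_sec _ _ _ _ hR]
  · simp only [sec, toCentre_assemble]
    ext t s
    rw [Matrix.diagonal_mul]
    simp only [secTo, Matrix.of_apply, h1, mul_assoc]
  · simp only [sec, fromCentre_assemble]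
    change _ = D.secFrom q g * Matrix.diagonal fun t => (u t)⁻¹
    ext s t
    rw [Matrix.mul_diagonal]
    simp only [secFrom, Matrix.of_apply, ← h2 t]
    field_simp [hu t]

variable [DecidableEq K]

/-- Diagonalise PQ at the centre. In an eigenbasis of QP, the maps P and Q then intertwine two
diagonal matrices, and distinctness of the eigenvalues leaves only the entries pairing t with `emb
t`, which are the scalars p and q. -/
theorem exists_secTo_secFrom {x : RepSpace S.dim} (hx : x ∈ momentFibre S.dim lam)
    {g : Matrix S.OuterIndex K ℂ} {g' : Matrix K S.OuterIndex ℂ} (h1 : g * g' = 1)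
    (h2 : g' * g = 1) (h3 : dualResidue x * g = g * Matrix.diagonal D.eig) :
    ∃ (u : GL (Fin (S.dim .centre)) ℂ) (p q : Fin (S.dim .centre) → ℂ),
      (∀ t, p t * q t = D.eig (D.emb t)) ∧ D.secTo p g' = u.val * toCentre x ∧
      D.secFrom q g = fromCentre x * u⁻¹.val := by
  obtain ⟨u, hu⟩ := D.exists_diagonalisation_centre hx
  have hu' : u⁻¹.val * u.val = 1 := by simp
  have h3' : g' * dualResidue x = Matrix.diagonal D.eig * g' := by
    calc g' * dualResidue x = g' * (dualResidue x * g) * g' := by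
          rw [Matrix.mul_assoc, Matrix.mul_assoc, h1, Matrix.mul_one]
      _ = _ := by rw [h3, ← Matrix.mul_assoc, h2, Matrix.one_mul]
  set P := u.val * toCentre x with hP
  set Q := fromCentre x * u⁻¹.val with hQ
  have hPQ : P * Q = Matrix.diagonal fun t => D.eig (D.emb t) := by
    rw [← hu, hP, hQ]; simp only [Matrix.mul_assoc]
  have hQP : Q * P = dualResidue x := by
    rw [hP, hQ, Matrix.mul_assoc, ← Matrix.mul_assoc u⁻¹.val, hu', Matrix.one_mul, dualResidue]
  have hA : Matrix.diagonal (fun t => D.eig (D.emb t)) * (P * g) =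
      P * g * Matrix.diagonal D.eig := by
    rw [← hPQ, Matrix.mul_assoc, ← Matrix.mul_assoc Q, hQP, h3, ← Matrix.mul_assoc]
  have hB : g' * Q * Matrix.diagonal (fun t => D.eig (D.emb t)) =
      Matrix.diagonal D.eig * (g' * Q) := by
    rw [← hPQ, Matrix.mul_assoc, ← Matrix.mul_assoc Q, hQP, ← Matrix.mul_assoc, h3',
      Matrix.mul_assoc]
  have hA' : ∀ t k, k ≠ D.emb t → (P * g) t k = 0 := by
    intro t k hk
    have := congrFun (congrFun hA t) k
    rw [Matrix.diagonal_mul, Matrix.mul_diagonal, mul_comm] at this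
    by_contra h
    exact hk (D.eig_inj (mul_left_cancel₀ h this)).symm
  have hB' : ∀ t k, k ≠ D.emb t → (g' * Q) k t = 0 := by
    intro t k hk
    have := congrFun (congrFun hB k) t
    rw [Matrix.diagonal_mul, Matrix.mul_diagonal, mul_comm] at this
    by_contra h
    exact hk (D.eig_inj (mul_right_cancel₀ h this)).symm
  have e1 : D.secTo (fun t => (P * g) t (D.emb t)) g' = P := by
    ext t s
    have : P = P * g * g' := by rw [Matrix.mul_assoc, h1, Matrix.mul_one]
    conv_rhs => rw [this]
    rw [Matrix.mul_apply, Finset.sum_eq_single (D.emb t)]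
    · rfl
    · intro k _ hk
      rw [hA' t k hk, zero_mul]
    · exact fun h => absurd (Finset.mem_univ _) h
  have e2 : D.secFrom (fun t => (g' * Q) (D.emb t) t) g = Q := by
    ext s t
    have : Q = g * (g' * Q) := by rw [← Matrix.mul_assoc, h1, Matrix.one_mul]
    conv_rhs => rw [this]
    rw [Matrix.mul_apply, Finset.sum_eq_single (D.emb t)]
    · rfl
    · intro k _ hk
      rw [hB' t k hk, mul_zero]
    · exact fun h => absurd (Finset.mem_univ _) h
  refine ⟨u, _, _, fun t => ?_, e1, e2⟩
  have h4 := D.secTo_mul_secFrom h2 (fun t => (P * g) t (D.emb t)) (fun t => (g' * Q) (D.emb t) t)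
  rw [e1, e2, hPQ] at h4
  simpa using (congrFun (congrFun h4 t) t).symm

theorem outerMoment_sub_block {x : RepSpace S.dim} (hx : x ∈ momentFibre S.dim lam)
    (p : S.OuterNode) : outerMoment (outerRep x) p - block (dualResidue x) p =
      Matrix.scalar _ (lam (S.outer p)) := by
  rw [← momentMap_outer, hx]

/-- Reduce (P, Q) to scalars p_t, q_t. Where p_t = 0, first let q_t tend to 0, then replace p_t by
1. Each move is a limit along a torus orbit, so the invariant keeps its value. Finally rescale every
p_t to 1, which forces q_t to be the eigenvalue. -/
theorem invariant_eq_sec {f : momentFibre S.dim lam → ℂ} (hf : f ∈ gaugeInvariants S.dim lam)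
    (hcont : Continuous f) (x : momentFibre S.dim lam)
    {g : Matrix S.OuterIndex K ℂ} {g' : Matrix K S.OuterIndex ℂ} (h1 : g * g' = 1)
    (h2 : g' * g = 1) (h3 : dualResidue x.1 * g = g * Matrix.diagonal D.eig)
    (hmem : D.sec (fun _ => 1) (fun t => D.eig (D.emb t)) g g' (outerRep x.1) ∈
      momentFibre S.dim lam) : f x = f ⟨_, hmem⟩ := by
  have hR : ∀ p q, ¬ IsArrow (S.outer p) (S.outer q) → outerRep x.1 p q = 0 :=
    fun p q h => outerRep_eq_zero _ h
  have hM : g * Matrix.diagonal D.eig * g' = dualResidue x.1 := by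
    rw [← h3, Matrix.mul_assoc, h1, Matrix.mul_one]
  have mem : ∀ p q : Fin (S.dim .centre) → ℂ, (∀ t, p t * q t = D.eig (D.emb t)) →
      D.sec p q g g' (outerRep x.1) ∈ momentFibre S.dim lam := fun p q hpq =>
    D.sec_mem h2 hpq hR fun p => by rw [hM, outerMoment_sub_block x.2]
  obtain ⟨u, p, q, hpq, hP, hQ⟩ := D.exists_secTo_secFrom x.2 h1 h2 h3
  have s1 : f ⟨_, mem p q hpq⟩ = f x :=
    D.full.invariant_eq_of_centre D.legEigenvalue_injective hf x ⟨_, mem p q hpq⟩ u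
      (D.outerRep_sec _ _ _ _ hR) (by rw [← hP]; exact toCentre_assemble _ _ _ _)
      (by rw [← hQ]; exact fromCentre_assemble _ _ _ _)
  -- Lines in the fibre over a fixed dual residue: p_t = 0 forces the eigenvalue to vanish, so q_t
  -- may be scaled freely and, once q_t = 0, p_t may be chosen freely.
  let q1 : ℂ → Fin (S.dim .centre) → ℂ := fun s t => if p t = 0 then s * q t else q t
  have hq1 : ∀ s t, p t * q1 s t = D.eig (D.emb t) := by
    intro s t
    by_cases h : p t = 0
    · rw [← hpq t, h, zero_mul, zero_mul]
    · simp only [q1, if_neg h, hpq]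
  have hq1c : Continuous q1 := continuous_pi fun t => by
    by_cases h : p t = 0
    · simp only [q1, if_pos h]; fun_prop
    · simp only [q1, if_neg h]; fun_prop
  let p1 : ℂ → Fin (S.dim .centre) → ℂ := fun s t => if p t = 0 then s else p t
  have hp1 : ∀ s t, p1 s t * q1 0 t = D.eig (D.emb t) := by
    intro s t
    by_cases h : p t = 0
    · simp only [q1, p1, if_pos h, zero_mul, mul_zero, ← hpq t, h]
    · simp only [q1, p1, if_neg h, hpq]
  have hp1c : Continuous p1 := continuous_pi fun t => by
    by_cases h : p t = 0
    · simp only [p1, if_pos h]; fun_prop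
    · simp only [p1, if_neg h]; fun_prop
  have s2 : f ⟨_, mem p (q1 0) (hq1 0)⟩ = f ⟨_, mem p (q1 1) (hq1 1)⟩ := by
    refine eq_of_continuous_of_forall_ne (h := fun s => f ⟨_, mem p (q1 s) (hq1 s)⟩)
      (hcont.comp ((D.continuous_sec continuous_const hq1c _ _ _).subtype_mk _)) fun s hs => ?_
    refine (D.invariant_sec_smul hf hR _ _ (fun t => if p t = 0 then s else 1) (fun t => ?_)
      (fun t => ?_) fun t => ?_).symm
    · split_ifs
      · exact hs
      · exact one_ne_zero
    · split_ifs with h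
      · rw [h, mul_zero]
      · rw [one_mul]
    · by_cases h : p t = 0
      · simp only [q1, if_pos h, one_mul]
      · simp only [q1, if_neg h, one_mul]
  have s3 : f ⟨_, mem (p1 0) (q1 0) (hp1 0)⟩ = f ⟨_, mem (p1 1) (q1 0) (hp1 1)⟩ := by
    refine eq_of_continuous_of_forall_ne (h := fun s => f ⟨_, mem (p1 s) (q1 0) (hp1 s)⟩)
      (hcont.comp ((D.continuous_sec hp1c continuous_const _ _ _).subtype_mk _)) fun s hs => ?_
    refine D.invariant_sec_smul hf hR _ _ (fun t => if p t = 0 then s else 1) (fun t => ?_)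
      (fun t => ?_) fun t => ?_
    · split_ifs
      · exact hs
      · exact one_ne_zero
    · by_cases h : p t = 0
      · simp only [p1, if_pos h, mul_one]
      · simp only [p1, if_neg h, one_mul]
    · by_cases h : p t = 0
      · simp only [q1, if_pos h, zero_mul, mul_zero]
      · simp only [q1, if_neg h, one_mul]
  have s4 : f ⟨_, mem (p1 1) (q1 0) (hp1 1)⟩ = f ⟨_, hmem⟩ := by
    refine D.invariant_sec_smul hf hR _ _ (p1 1) (fun t => ?_) (fun t => (mul_one _).symm)
      fun t => hp1 1 t
    by_cases h : p t = 0
    · simp only [p1, if_pos h]; exact one_ne_zero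
    · simp only [p1, if_neg h]; exact h
  have e1 : q1 1 = q := by
    funext t; simp only [q1, one_mul, ite_self]
  have e2 : p1 0 = p := by
    funext t; simp only [p1]; split_ifs with h
    · exact h.symm
    · rfl
  rw [← s4, ← s3, ← s1]
  simp only [e1] at s2
  rw [← s2]
  simp only [e2]

end SpectralData

end StarData

/-! ## Invariants are polynomials in the dual residue -/

namespace StarData

variable {k : ℕ}

/-- The functions on `μ⁻¹(lam)` which are polynomials in the entries of the dual residue and of the
maps on the legs other than the last one. -/
def dualRing (S : StarData (Option (Fin k))) (lam : S.Vertex → ℂ) :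
    Subalgebra ℂ (momentFibre S.dim lam → ℂ) :=
  Algebra.adjoin ℂ
    ({f | ∃ s t, f = fun x => dualResidue x.1 s t} ∪
     ({f | ∃ p q a b, f = fun x => (outerRep x.1 p q).1 a b} ∪
      {f | ∃ p q a b, f = fun x => (outerRep x.1 p q).2 a b}))

variable {S : StarData (Option (Fin k))} {lam : S.Vertex → ℂ}

theorem dualResidue_mem_dualRing (s t : S.OuterIndex) :
    (fun x => dualResidue x.1 s t) ∈ dualRing S lam :=
  Algebra.subset_adjoin (Or.inl ⟨s, t, rfl⟩)

theorem outerRep_fst_mem_dualRing (p q : S.OuterNode) (a b) :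
    (fun x => (outerRep x.1 p q).1 a b) ∈ dualRing S lam :=
  Algebra.subset_adjoin (Or.inr (Or.inl ⟨p, q, a, b, rfl⟩))

theorem outerRep_snd_mem_dualRing (p q : S.OuterNode) (a b) :
    (fun x => (outerRep x.1 p q).2 a b) ∈ dualRing S lam :=
  Algebra.subset_adjoin (Or.inr (Or.inr ⟨p, q, a, b, rfl⟩))

theorem const_mem_dualRing (c : ℂ) : (fun _ => c) ∈ dualRing S lam :=
  (dualRing S lam).algebraMap_mem c

theorem aeval_dualResidue_mem_dualRing (p : ℂ[X]) (s t : S.OuterIndex) :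
    (fun x => aeval (dualResidue x.1) p s t) ∈ dualRing S lam := by
  induction p using Polynomial.induction_on' generalizing s t with
  | add p q hp hq =>
    convert add_mem (hp s t) (hq s t) using 1
    funext x
    simp
  | monomial n a =>
    induction n generalizing s t with
    | zero =>
      convert const_mem_dualRing (S := S) (lam := lam) (if s = t then a else 0) using 1
      funext x
      rw [Polynomial.aeval_monomial, pow_zero, mul_one, Matrix.algebraMap_matrix_apply]
      rfl
    | succ n ih =>
      convert sum_mem (t := Finset.univ) fun r _ =>
        mul_mem (ih s r) (dualResidue_mem_dualRing r t) using 1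
      funext x
      rw [Polynomial.aeval_monomial, pow_succ, ← mul_assoc, ← Polynomial.aeval_monomial,
        Matrix.mul_apply, Finset.sum_apply]
      rfl

theorem entry_mem_fibreCoordinateRing (S : StarData (Option (Fin k))) (lam : S.Vertex → ℂ)
    (v w : S.Vertex) :
    (∀ a b, (fun x => fwd x.1 v w a b) ∈ fibreCoordinateRing S.dim lam) ∧
    (∀ a b, (fun x => bwd x.1 v w a b) ∈ fibreCoordinateRing S.dim lam) := by
  by_cases h : IsArrow v w
  · refine ⟨fun a b => Algebra.subset_adjoin (Or.inl ⟨v, w, ⟨h⟩, a, b, ?_⟩),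
      fun a b => Algebra.subset_adjoin (Or.inr ⟨v, w, ⟨h⟩, a, b, ?_⟩)⟩
    · funext x; rw [fwd_arrow x.1 ⟨h⟩]
    · funext x; rw [bwd_arrow x.1 ⟨h⟩]
  · refine ⟨fun a b => ?_, fun a b => ?_⟩
    · simp only [fwd_eq_zero _ h]; exact zero_mem _
    · simp only [bwd_eq_zero _ h]; exact zero_mem _

theorem dualRing_le : dualRing S lam ≤ fibreCoordinateRing S.dim lam := by
  refine Algebra.adjoin_le ?_
  rintro f (⟨s, t, rfl⟩ | ⟨p, q, a, b, rfl⟩ | ⟨p, q, a, b, rfl⟩)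
  · rw [SetLike.mem_coe]
    convert sum_mem (t := Finset.univ) fun r _ =>
      mul_mem ((entry_mem_fibreCoordinateRing S lam (S.outer s.1.1) .centre).2 s.2 r)
        ((entry_mem_fibreCoordinateRing S lam (S.outer t.1.1) .centre).1 r t.2) using 1
    funext x
    rw [Finset.sum_apply]
    rfl
  · exact (entry_mem_fibreCoordinateRing S lam _ _).1 a b
  · exact (entry_mem_fibreCoordinateRing S lam _ _).2 a b

namespace SpectralData

variable {K : Type} [Fintype K] [DecidableEq K] (D : SpectralData S lam K)

/-! ### Spectral projections and local algebraic eigenbases. -/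

/-- The spectral projections of a matrix with the given eigenvalues. -/
def proj (M : Matrix S.OuterIndex S.OuterIndex ℂ) (l : K) : Matrix S.OuterIndex S.OuterIndex ℂ :=
  aeval M (Lagrange.basis Finset.univ D.eig l)

/-- Lagrange interpolation gives a polynomial in M acting as 1 on one eigenline and 0 on the others,
hence the rank one projection onto that line. -/
theorem proj_apply {M : Matrix S.OuterIndex S.OuterIndex ℂ} {g : Matrix S.OuterIndex K ℂ}
    {g' : Matrix K S.OuterIndex ℂ} (h1 : g * g' = 1) (h3 : M * g = g * Matrix.diagonal D.eig)
    (l : K) (s t : S.OuterIndex) : D.proj M l s t = g s l * g' l t := by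
  have h4 := Matrix.aeval_mul_of_mul_eq h3 (Lagrange.basis Finset.univ D.eig l)
  have h5 : D.proj M l = g * Matrix.diagonal (fun i => if i = l then (1 : ℂ) else 0) * g' := by
    rw [proj, ← Matrix.mul_one (aeval M _), ← h1, ← Matrix.mul_assoc, h4]
    congr 3
    funext i
    split_ifs with h
    · rw [h, Lagrange.eval_basis_self D.eig_inj.injOn (Finset.mem_univ l)]
    · rw [Lagrange.eval_basis_of_ne (Ne.symm h) (Finset.mem_univ i)]
  rw [h5, Matrix.mul_apply, Finset.sum_eq_single l]
  · simp
  · intro i _ hi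
    simp [hi]
  · exact fun h => absurd (Finset.mem_univ _) h

/-- The product of chosen diagonal entries of the spectral projections. -/
def minor (a : K → S.OuterIndex) (M : Matrix S.OuterIndex S.OuterIndex ℂ) : ℂ :=
  ∏ l, D.proj M l (a l) (a l)

/-- The basis of eigenvectors formed by columns of the spectral projections. -/
def basis (a : K → S.OuterIndex) (M : Matrix S.OuterIndex S.OuterIndex ℂ) :
    Matrix S.OuterIndex K ℂ :=
  Matrix.of fun s l => D.proj M l s (a l)

/-- The basis dual to the one formed by columns of the spectral projections. -/
def dualBasis (a : K → S.OuterIndex) (M : Matrix S.OuterIndex S.OuterIndex ℂ) :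
    Matrix K S.OuterIndex ℂ :=
  Matrix.of fun l s => D.proj M l (a l) s / D.proj M l (a l) (a l)

/-- Each rank one projection has trace 1; expanding the product of all the traces gives the sum. The
loci where one of these products is nonzero therefore cover the fibre. -/
theorem sum_minor {x : RepSpace S.dim} (hx : x ∈ momentFibre S.dim lam) :
    ∑ a, D.minor a (dualResidue x) = 1 := by
  obtain ⟨g, g', h1, h2, h3⟩ := D.exists_diagonalisation hx
  have h4 : ∀ l, ∑ s, D.proj (dualResidue x) l s s = 1 := by
    intro l
    have := congrFun (congrFun h2 l) l
    rw [Matrix.mul_apply, Matrix.one_apply_eq] at this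
    rw [← this]
    refine Finset.sum_congr rfl fun s _ => ?_
    rw [D.proj_apply h1 h3, mul_comm]
  have h5 := Finset.prod_univ_sum (fun _ : K => (Finset.univ : Finset S.OuterIndex))
    fun l s => D.proj (dualResidue x) l s s
  rw [Fintype.piFinset_univ, Finset.prod_eq_one fun l _ => h4 l] at h5
  exact h5.symm

/-- Column a l of the l-th projection is the l-th eigenvector rescaled by a coordinate of its dual
vector, which is nonzero when the product is. The dual basis is rescaled inversely. -/
theorem basis_spec {x : RepSpace S.dim} (hx : x ∈ momentFibre S.dim lam) {a : K → S.OuterIndex}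
    (ha : D.minor a (dualResidue x) ≠ 0) :
    D.basis a (dualResidue x) * D.dualBasis a (dualResidue x) = 1 ∧
    D.dualBasis a (dualResidue x) * D.basis a (dualResidue x) = 1 ∧
    dualResidue x * D.basis a (dualResidue x) =
      D.basis a (dualResidue x) * Matrix.diagonal D.eig := by
  obtain ⟨g, g', h1, h2, h3⟩ := D.exists_diagonalisation hx
  have hne : ∀ l, g (a l) l * g' l (a l) ≠ 0 := fun l => by
    rw [← D.proj_apply h1 h3]
    exact Finset.prod_ne_zero_iff.mp ha l (Finset.mem_univ l)
  have e1 : D.basis a (dualResidue x) = g * Matrix.diagonal fun l => g' l (a l) := by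
    ext s l
    rw [Matrix.mul_diagonal, basis, Matrix.of_apply, D.proj_apply h1 h3]
  have e2 : D.dualBasis a (dualResidue x) = Matrix.diagonal (fun l => (g' l (a l))⁻¹) * g' := by
    ext l s
    rw [Matrix.diagonal_mul, dualBasis, Matrix.of_apply, D.proj_apply h1 h3, D.proj_apply h1 h3,
      mul_div_mul_left _ _ (left_ne_zero_of_mul (hne l)), div_eq_inv_mul]
  have e3 : Matrix.diagonal (fun l => g' l (a l)) * Matrix.diagonal (fun l => (g' l (a l))⁻¹) =
      1 := by
    rw [Matrix.diagonal_mul_diagonal, ← Matrix.diagonal_one]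
    congr 1
    funext l
    exact mul_inv_cancel₀ (right_ne_zero_of_mul (hne l))
  refine ⟨?_, ?_, ?_⟩
  · rw [e1, e2, Matrix.mul_assoc, ← Matrix.mul_assoc (Matrix.diagonal _), e3, Matrix.one_mul, h1]
  · rw [e1, e2, Matrix.mul_assoc, ← Matrix.mul_assoc g', h2, Matrix.one_mul,
      mul_eq_one_comm.mp e3]
  · rw [e1, ← Matrix.mul_assoc, h3, Matrix.mul_assoc, Matrix.mul_assoc,
      Matrix.diagonal_mul_diagonal, Matrix.diagonal_mul_diagonal]
    simp only [mul_comm]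

/-- The section of the dual residue given by columns of the spectral projections. -/
def spectralSec (a : K → S.OuterIndex) (x : RepSpace S.dim) : RepSpace S.dim :=
  D.sec (fun _ => 1) (fun t => D.eig (D.emb t)) (D.basis a (dualResidue x))
    (D.dualBasis a (dualResidue x)) (outerRep x)

theorem spectralSec_mem {x : RepSpace S.dim} (hx : x ∈ momentFibre S.dim lam)
    {a : K → S.OuterIndex} (ha : D.minor a (dualResidue x) ≠ 0) :
    D.spectralSec a x ∈ momentFibre S.dim lam := by
  obtain ⟨h1, h2, h3⟩ := D.basis_spec hx ha
  refine D.sec_mem h2 (fun _ => one_mul _) (fun p q h => outerRep_eq_zero _ h) fun p => ?_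
  rw [← h3, Matrix.mul_assoc, h1, Matrix.mul_one, outerMoment_sub_block hx]

theorem proj_mem_dualRing (l : K) (s t : S.OuterIndex) :
    (fun x => D.proj (dualResidue x.1) l s t) ∈ dualRing S lam :=
  aeval_dualResidue_mem_dualRing _ s t

theorem minor_mem_dualRing (a : K → S.OuterIndex) :
    (fun x => D.minor a (dualResidue x.1)) ∈ dualRing S lam := by
  convert prod_mem (t := Finset.univ) fun l _ => D.proj_mem_dualRing l (a l) (a l) using 1
  funext x
  rw [Finset.prod_apply]
  rfl

/-- The only denominator in row l of the dual basis is one of the factors of the product. -/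
theorem exists_minor_mul_dualBasis (a : K → S.OuterIndex) (l : K) (s : S.OuterIndex) :
    ∃ F ∈ dualRing S lam, ∀ x : momentFibre S.dim lam, D.minor a (dualResidue x.1) ≠ 0 →
      D.minor a (dualResidue x.1) * D.dualBasis a (dualResidue x.1) l s = F x := by
  refine ⟨_, mul_mem (prod_mem (t := Finset.univ.erase l)
    fun i _ => D.proj_mem_dualRing i (a i) (a i)) (D.proj_mem_dualRing l (a l) s),
    fun x hx => ?_⟩
  have hne := Finset.prod_ne_zero_iff.mp hx l (Finset.mem_univ l)
  rw [minor, ← Finset.prod_erase_mul _ _ (Finset.mem_univ l), Pi.mul_apply, Finset.prod_apply,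
    dualBasis, Matrix.of_apply, mul_assoc, mul_div_cancel₀ _ hne]

/-- Pulling a regular function back along the local section yields polynomials in the dual residue
and the outer maps, up to powers of the product. The dual basis enters only through the maps to the
centre, so denominators arise only from those. -/
theorem exists_pow_mul_spectralSec (a : K → S.OuterIndex) {f : momentFibre S.dim lam → ℂ}
    (hf : f ∈ fibreCoordinateRing S.dim lam) :
    ∃ n : ℕ, ∃ F ∈ dualRing S lam, ∀ x : momentFibre S.dim lam,
      D.minor a (dualResidue x.1) ≠ 0 → ∀ h : D.spectralSec a x.1 ∈ momentFibre S.dim lam,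
      D.minor a (dualResidue x.1) ^ n * f ⟨_, h⟩ = F x := by
  induction hf using Algebra.adjoin_induction with
  | mem f hf =>
    rcases hf with ⟨v, w, e, c, b, rfl⟩ | ⟨v, w, e, c, b, rfl⟩
    · rcases v with _ | ⟨_ | i, j⟩
      · exact absurd e.down (not_isArrow_centre _)
      · exact ⟨0, _, const_mem_dualRing (shiftIn _ _ c b), fun x _ _ => one_mul _⟩
      · rcases w with _ | ⟨_ | i', j'⟩
        · have hj : j.val = 0 := e.down
          obtain ⟨F, hF, hF'⟩ := D.exists_minor_mul_dualBasis a (D.emb c) ⟨⟨⟨i, j⟩, hj⟩, b⟩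
          refine ⟨1, F, hF, fun x hx h => ?_⟩
          rw [← hF' x hx, pow_one]
          simp only [spectralSec, sec, assemble, assembleFwd, dif_pos hj, Matrix.of_apply, secTo,
            one_mul]
        · exact ⟨0, _, zero_mem _, fun x _ _ => one_mul _⟩
        · exact ⟨0, _, outerRep_fst_mem_dualRing ⟨i, j⟩ ⟨i', j'⟩ c b, fun x _ _ => one_mul _⟩
    · rcases v with _ | ⟨_ | i, j⟩
      · exact absurd e.down (not_isArrow_centre _)
      · exact ⟨0, _, const_mem_dualRing (shiftOut _ _ (fun q =>
          S.legEigenvalue lam none (j.val + 1 + q) - S.legEigenvalue lam none w.depth) c b),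
          fun x _ _ => one_mul _⟩
      · rcases w with _ | ⟨_ | i', j'⟩
        · have hj : j.val = 0 := e.down
          refine ⟨0, _, mul_mem (D.proj_mem_dualRing (D.emb b) ⟨⟨⟨i, j⟩, hj⟩, c⟩ (a (D.emb b)))
            (const_mem_dualRing (D.eig (D.emb b))), fun x hx h => ?_⟩
          rw [pow_zero, one_mul]
          simp only [spectralSec, sec, assemble, assembleBwd, dif_pos hj, Matrix.of_apply, secFrom,
            basis, Pi.mul_apply]
        · exact ⟨0, _, zero_mem _, fun x _ _ => one_mul _⟩
        · exact ⟨0, _, outerRep_snd_mem_dualRing ⟨i, j⟩ ⟨i', j'⟩ c b, fun x _ _ => one_mul _⟩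
  | algebraMap r => exact ⟨0, _, (dualRing S lam).algebraMap_mem r, fun x _ _ => one_mul _⟩
  | add f g _ _ hf hg =>
    obtain ⟨n, F, hF, hF'⟩ := hf
    obtain ⟨m, G, hG, hG'⟩ := hg
    refine ⟨n + m, _, add_mem (mul_mem (pow_mem (D.minor_mem_dualRing a) m) hF)
      (mul_mem (pow_mem (D.minor_mem_dualRing a) n) hG), fun x hx h => ?_⟩
    simp only [Pi.add_apply, Pi.mul_apply, Pi.pow_apply, ← hF' x hx h, ← hG' x hx h]
    ring
  | mul f g _ _ hf hg =>
    obtain ⟨n, F, hF, hF'⟩ := hf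
    obtain ⟨m, G, hG, hG'⟩ := hg
    refine ⟨n + m, _, mul_mem hF hG, fun x hx h => ?_⟩
    simp only [Pi.mul_apply, ← hF' x hx h, ← hG' x hx h]
    ring

/-- Every invariant regular function is a polynomial in the entries of the dual residue and of the
maps on the legs other than the last one. -/
theorem invariantRing_le_dualRing (D : SpectralData S lam K) : invariantRing S.dim lam ≤ dualRing S lam := by
  rintro f ⟨hf1, hf2⟩
  have hcont := continuous_of_mem_fibreCoordinateRing hf1
  let h : (K → S.OuterIndex) → dualRing S lam := fun a => ⟨_, D.minor_mem_dualRing a⟩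
  have hspan : Ideal.span (Set.range h) = ⊤ := by
    rw [Ideal.eq_top_iff_one]
    have : ∑ a, h a = 1 := by
      refine Subtype.ext (funext fun x => ?_)
      rw [AddSubmonoidClass.coe_finsetSum, Finset.sum_apply]
      exact D.sum_minor x.2
    rw [← this]
    exact sum_mem fun a _ => Ideal.subset_span ⟨a, rfl⟩
  -- Local-to-global step: the products generate the unit ideal, so it suffices that f lies in the
  -- ring after multiplication by a power of each.
  have key := Submodule.mem_of_span_eq_top_of_smul_pow_mem
    (LinearMap.range (Algebra.linearMap (dualRing S lam) (momentFibre S.dim lam → ℂ)))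
    (Set.range h) hspan f ?_
  · obtain ⟨F, hF⟩ := key
    rw [← hF]
    exact F.2
  · rintro ⟨_, a, rfl⟩
    obtain ⟨n, F, hF, hF'⟩ := D.exists_pow_mul_spectralSec a hf1
    -- One factor more than needed to clear denominators, so that both sides vanish where the
    -- product is zero and the section is unavailable.
    refine ⟨n + 1, ⟨_, mul_mem (D.minor_mem_dualRing a) hF⟩, ?_⟩
    funext x
    change D.minor a (dualResidue x.1) * F x = D.minor a (dualResidue x.1) ^ (n + 1) * f x
    by_cases hx : D.minor a (dualResidue x.1) = 0
    · rw [hx, zero_mul, pow_succ, mul_zero, zero_mul]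
    · obtain ⟨h1, h2, h3⟩ := D.basis_spec x.2 hx
      rw [D.invariant_eq_sec hf2 hcont x h1 h2 h3 (D.spectralSec_mem x.2 hx),
        ← hF' x hx (D.spectralSec_mem x.2 hx)]
      simp only [spectralSec]
      ring

end SpectralData

end StarData

/-! ## Comparison of rings of invariants -/

/-- Two algebras of functions which correspond under a relation between the underlying sets are
isomorphic. -/
theorem nonempty_algEquiv_of_rel {X Y : Type} {A : Subalgebra ℂ (X → ℂ)}
    {B : Subalgebra ℂ (Y → ℂ)} (r : X → Y → Prop) (hl : ∀ x, ∃ y, r x y) (hr : ∀ y, ∃ x, r x y)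
    (hA : ∀ f ∈ A, ∃ f' ∈ B, ∀ x y, r x y → f x = f' y)
    (hB : ∀ f' ∈ B, ∃ f ∈ A, ∀ x y, r x y → f x = f' y) : Nonempty (A ≃ₐ[ℂ] B) := by
  choose s hs using hr
  have hmem : ∀ f ∈ A, (fun y => f (s y)) ∈ B := by
    intro f hf
    obtain ⟨f', hf', h⟩ := hA f hf
    convert hf' using 1
    exact funext fun y => h _ _ (hs y)
  let φ : A →ₐ[ℂ] B :=
    { toFun := fun f => ⟨_, hmem f.1 f.2⟩
      map_one' := rfl
      map_mul' := fun _ _ => rfl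
      map_zero' := rfl
      map_add' := fun _ _ => rfl
      commutes' := fun _ => rfl }
  refine ⟨AlgEquiv.ofBijective φ ⟨fun f g hfg => ?_, fun g => ?_⟩⟩
  · refine Subtype.ext (funext fun x => ?_)
    obtain ⟨y, hy⟩ := hl x
    obtain ⟨f', -, hf'⟩ := hA f.1 f.2
    obtain ⟨g', -, hg'⟩ := hA g.1 g.2
    have := congrFun (congrArg Subtype.val hfg) y
    change f.1 (s y) = g.1 (s y) at this
    rw [hf' _ _ hy, hg' _ _ hy, ← hf' _ _ (hs y), ← hg' _ _ (hs y), this]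
  · obtain ⟨f, hf, h⟩ := hB g.1 g.2
    exact ⟨⟨f, hf⟩, Subtype.ext (funext fun y => h _ _ (hs y))⟩

theorem nonempty_iso_of_algEquiv {A B : Type} [CommRing A] [CommRing B] [Algebra ℂ A]
    [Algebra ℂ B] (e : A ≃ₐ[ℂ] B) :
    Nonempty (Over.mk (Spec.map (CommRingCat.ofHom (algebraMap ℂ A))) ≅
      Over.mk (Spec.map (CommRingCat.ofHom (algebraMap ℂ B)))) := by
  refine ⟨Over.isoMk (Scheme.Spec.mapIso e.toRingEquiv.toCommRingCatIso.symm.op) ?_⟩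
  change Spec.map _ ≫ Spec.map _ = Spec.map _
  rw [← Spec.map_comp]
  congr 1
  ext c
  exact e.symm.commutes c

namespace StarData

variable {k : ℕ} {S : StarData (Option (Fin k))}

/-- Any diagonalisable pair satisfying the outer moment equations is realised: take p = 1 and q the
eigenvalues in the section. Thus the possible pairs are described without reference to the centre or
the last leg. -/
theorem SpectralData.exists_point {lam : S.Vertex → ℂ} {K : Type} [Fintype K] [DecidableEq K]
    (D : SpectralData S lam K) {M : Matrix S.OuterIndex S.OuterIndex ℂ} {R : S.OuterRep}
    {g : Matrix S.OuterIndex K ℂ} {g' : Matrix K S.OuterIndex ℂ} (h1 : g * g' = 1)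
    (h2 : g' * g = 1) (h3 : M * g = g * Matrix.diagonal D.eig)
    (hR : ∀ p q, ¬ IsArrow (S.outer p) (S.outer q) → R p q = 0)
    (hM : ∀ p, outerMoment R p - block M p = Matrix.scalar _ (lam (S.outer p))) :
    ∃ y ∈ momentFibre S.dim lam, dualResidue y = M ∧ outerRep y = R := by
  have h4 : g * Matrix.diagonal D.eig * g' = M := by
    rw [← h3, Matrix.mul_assoc, h1, Matrix.mul_one]
  exact ⟨D.sec (fun _ => 1) (fun t => D.eig (D.emb t)) g g' R,
    D.sec_mem h2 (fun _ => one_mul _) hR (by rwa [h4]),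
    by rw [D.dualResidue_sec g g' (fun _ => one_mul _), h4], D.outerRep_sec g g' _ _ hR⟩

theorem block_add_scalar (M : Matrix S.OuterIndex S.OuterIndex ℂ) (c : ℂ) (p : S.OuterNode) :
    block (M + Matrix.scalar _ c) p =
      block M p + Matrix.scalar _ (if p.2.val = 0 then c else 0) := by
  rw [block, block]
  split_ifs with h
  · ext a b
    simp [Matrix.diagonal_apply, Sigma.ext_iff]
  · simp

theorem add_scalar_mul {K : Type} [Fintype K] [DecidableEq K]
    {M : Matrix S.OuterIndex S.OuterIndex ℂ} {g : Matrix S.OuterIndex K ℂ} {e : K → ℂ}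
    (h : M * g = g * Matrix.diagonal e) (c : ℂ) :
    (M + Matrix.scalar _ c) * g = g * Matrix.diagonal fun l => e l + c := by
  ext s l
  rw [Matrix.add_mul, h, Matrix.add_apply, Matrix.mul_diagonal, Matrix.mul_diagonal,
    Matrix.scalar_apply, Matrix.diagonal_mul]
  ring

/-! ### The correspondence between the two quivers. -/

/-- The dual residue of a representation of the incremented quiver. -/
def incDualResidue (x : RepSpace S.increment.dim) : Matrix S.OuterIndex S.OuterIndex ℂ :=
  dualResidue (S := S.increment) x

/-- The maps on the legs other than the last one for a representation of the incremented quiver. -/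
def incOuterRep (x : RepSpace S.increment.dim) : S.OuterRep := outerRep (S := S.increment) x

/-- A representation of the incremented quiver corresponds to a representation of the original one
if the dual residues differ by the scalar `c` and the maps on the legs other than the last one
agree. -/
def Corresponds (c : ℂ) (x : RepSpace S.increment.dim) (y : RepSpace S.dim) : Prop :=
  incDualResidue x = dualResidue y + Matrix.scalar _ c ∧ incOuterRep x = outerRep y

theorem projectParams_outer (lam : S.increment.Vertex → ℂ) (p : S.OuterNode) :
    S.projectParams lam (S.outer p) =
      lam (S.increment.outer p) + if p.2.val = 0 then lam .centre else 0 := by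
  change lam (S.increment.outer p) - (if p.2.val = 0 then -lam .centre else 0) = _
  split_ifs <;> ring

/-- The first parameter of the long leg becomes the central parameter, so it supplies the first
summand of the partial sum and the index moves by one. -/
theorem legEigenvalue_projectParams (lam : S.increment.Vertex → ℂ) (t : ℕ) :
    S.projectParams lam .centre - S.legEigenvalue (S.projectParams lam) none t =
      -S.increment.legEigenvalue lam none (t + 1) := by
  have h1 : S.increment.legEigenvalue lam none (t + 1) =
      -∑ j : Fin (S.len none + 1), if j.val < t + 1 then lam (.leg none j) else 0 := rfl
  rw [h1, Fin.sum_univ_succ, neg_neg, legEigenvalue, sub_neg_eq_add]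
  congr 1
  refine Finset.sum_congr rfl fun j _ => ?_
  simp only [Fin.val_succ, add_lt_add_iff_right]
  rfl

theorem IsAlmostAffine.card_outerIndex (hS : S.IsAlmostAffine) :
    Fintype.card S.OuterIndex = S.centralDim + 1 := by
  have h1 : Fintype.card S.OuterIndex = ∑ i : Fin k, S.legDim (some i) ⟨0, hS.len_pos _⟩ := by
    rw [Fintype.card_sigma]
    simp only [Fintype.card_fin]
    symm
    refine Fintype.sum_equiv
      { toFun := fun i => ⟨⟨i, ⟨0, hS.len_pos _⟩⟩, rfl⟩
        invFun := fun p => p.1.1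
        left_inv := fun i => rfl
        right_inv := ?_ } _ _ fun i => rfl
    rintro ⟨⟨i, a⟩, h⟩
    refine Subtype.ext (Sigma.ext rfl (heq_of_eq (Fin.ext h.symm)))
  have h2 := hS.sum_eq
  have h3 := hS.full_dim ⟨0, hS.len_pos _⟩
  rw [Fintype.sum_option, ← h1] at h2
  simp only at h3
  omega

/-- The eigenvalues of the dual residues for the incremented quiver. -/
def incSpectralData (hS : S.IsAlmostAffine) (lam : S.increment.Vertex → ℂ)
    (hgen : S.increment.IsGeneric lam) :
    SpectralData S.increment lam (Fin (S.centralDim + 1)) where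
  eig t := lam .centre - S.increment.legEigenvalue lam none t.val
  emb t := t
  full := hS.isFull.increment
  eig_inj s t h := hS.isFull.increment.legEigenvalue_injective lam hgen (sub_right_injective h)
  emb_inj := Function.injective_id
  eig_emb _ := rfl
  eig_eq_zero l hl := absurd ⟨l, rfl⟩ hl
  card_eq := by
    rw [Fintype.card_fin]
    exact hS.card_outerIndex

/-- The eigenvalues of the dual residues for the original quiver. -/
def projSpectralData (hS : S.IsAlmostAffine) (lam : S.increment.Vertex → ℂ)
    (hgen : S.increment.IsGeneric lam) :
    SpectralData S (S.projectParams lam) (Fin (S.centralDim + 1)) where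
  eig t := -S.increment.legEigenvalue lam none t.val
  -- Index 0 is the additional zero eigenvalue -ξ_0 of the dual residue, present because that matrix
  -- is one larger than the centre.
  emb := Fin.succ
  full := hS.isFull
  eig_inj s t h := hS.isFull.increment.legEigenvalue_injective lam hgen (neg_injective h)
  emb_inj := Fin.succ_injective _
  eig_emb t := (legEigenvalue_projectParams lam t.val).symm
  eig_eq_zero l hl := by
    have : l = 0 := by
      by_contra h
      exact hl ⟨l.pred h, Fin.succ_pred l h⟩
    rw [this, Fin.val_zero, legEigenvalue_zero, neg_zero]
  card_eq := by
    rw [Fintype.card_fin]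
    exact hS.card_outerIndex

section Transfer

variable (lam : S.increment.Vertex → ℂ)

/-- Subtracting λ_0 from the dual residue keeps its eigenbasis and turns one prescribed spectrum
into the other. On the blocks of the nodes adjacent to the centre it produces the shift in the
projected parameters. -/
theorem exists_corresponds_of_increment {x : RepSpace S.increment.dim} (hS : S.IsAlmostAffine)
    (hgen : S.increment.IsGeneric lam) (hx : x ∈ momentFibre S.increment.dim lam) :
    ∃ y ∈ momentFibre S.dim (S.projectParams lam), Corresponds (lam .centre) x y := by
  have h0 : ∃ (g : Matrix S.OuterIndex (Fin (S.centralDim + 1)) ℂ)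
      (g' : Matrix (Fin (S.centralDim + 1)) S.OuterIndex ℂ), g * g' = 1 ∧ g' * g = 1 ∧
      incDualResidue x * g = g * Matrix.diagonal (incSpectralData hS lam hgen).eig :=
    (incSpectralData hS lam hgen).exists_diagonalisation hx
  obtain ⟨g, g', h1, h2, h3⟩ := h0
  have h3' := add_scalar_mul h3 (-lam .centre)
  obtain ⟨y, hy, hy1, hy2⟩ := (projSpectralData hS lam hgen).exists_point
    (M := incDualResidue x + Matrix.scalar _ (-lam .centre)) (R := incOuterRep x) (g := g)
    (g' := g') h1 h2 (by
      rw [h3']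
      congr 2
      funext l
      change lam .centre - _ + -lam .centre = -_
      ring)
    (fun p q h => outerRep_eq_zero x h) (fun p => by
      have h4 : outerMoment (incOuterRep x) p - block (incDualResidue x) p =
        Matrix.scalar _ (lam (S.increment.outer p)) :=
          SpectralData.outerMoment_sub_block hx p
      rw [block_add_scalar, ← sub_sub, h4, projectParams_outer, ← map_sub]
      congr 1
      split_ifs <;> ring)
  refine ⟨y, hy, ?_, hy2.symm⟩
  rw [hy1, add_assoc, ← map_add, neg_add_cancel, map_zero, add_zero]

theorem exists_corresponds_of_projected {y : RepSpace S.dim} (hS : S.IsAlmostAffine)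
    (hgen : S.increment.IsGeneric lam) (hy : y ∈ momentFibre S.dim (S.projectParams lam)) :
    ∃ x ∈ momentFibre S.increment.dim lam, Corresponds (lam .centre) x y := by
  obtain ⟨g, g', h1, h2, h3⟩ := (projSpectralData hS lam hgen).exists_diagonalisation hy
  have h3' := add_scalar_mul h3 (lam .centre)
  have h3'' : (dualResidue y + Matrix.scalar _ (lam .centre)) * g =
      g * Matrix.diagonal (incSpectralData hS lam hgen).eig := by
    rw [h3']
    congr 2
    funext l
    change -_ + lam .centre = lam .centre - _
    ring
  let M := dualResidue y + Matrix.scalar _ (lam .centre)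
  let R := outerRep y
  have h6 : ∀ p : S.OuterNode, outerMoment R p - block M p =
      Matrix.scalar _ (lam (S.increment.outer p)) := by
    intro p
    rw [block_add_scalar, ← sub_sub, SpectralData.outerMoment_sub_block hy, projectParams_outer,
      ← map_sub, add_sub_cancel_right]
  obtain ⟨x, hx, hx1, hx2⟩ := SpectralData.exists_point (S := S.increment)
    (incSpectralData hS lam hgen) (M := M) (R := R) (g := g)
    (g' := g') h1 h2 h3'' (fun p q h => outerRep_eq_zero y h) h6
  exact ⟨x, hx, hx1, hx2⟩

theorem exists_dualRing_of_increment {f : momentFibre S.increment.dim lam → ℂ}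
    (hf : f ∈ dualRing S.increment lam) : ∃ f' ∈ dualRing S (S.projectParams lam),
      ∀ x y, Corresponds (lam .centre) x.1 y.1 → f x = f' y := by
  induction hf using Algebra.adjoin_induction with
  | mem f hf =>
    rcases hf with ⟨s, t, rfl⟩ | ⟨p, q, a, b, rfl⟩ | ⟨p, q, a, b, rfl⟩
    · refine ⟨_, add_mem (dualResidue_mem_dualRing (S := S) s t)
        (const_mem_dualRing ((Matrix.scalar S.OuterIndex (lam .centre)) s t)), fun x y h => ?_⟩
      exact congrFun (congrFun h.1 s) t
    · refine ⟨_, outerRep_fst_mem_dualRing (S := S) p q a b, fun x y h => ?_⟩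
      exact congrFun (congrFun (congrArg Prod.fst (congrFun (congrFun h.2 p) q)) a) b
    · refine ⟨_, outerRep_snd_mem_dualRing (S := S) p q a b, fun x y h => ?_⟩
      exact congrFun (congrFun (congrArg Prod.snd (congrFun (congrFun h.2 p) q)) a) b
  | algebraMap r => exact ⟨_, (dualRing S _).algebraMap_mem r, fun _ _ _ => rfl⟩
  | add f g _ _ hf hg =>
    obtain ⟨f', hf', h1⟩ := hf
    obtain ⟨g', hg', h2⟩ := hg
    exact ⟨_, add_mem hf' hg', fun x y h => congrArg₂ (· + ·) (h1 x y h) (h2 x y h)⟩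
  | mul f g _ _ hf hg =>
    obtain ⟨f', hf', h1⟩ := hf
    obtain ⟨g', hg', h2⟩ := hg
    exact ⟨_, mul_mem hf' hg', fun x y h => congrArg₂ (· * ·) (h1 x y h) (h2 x y h)⟩

theorem exists_dualRing_of_projected {f' : momentFibre S.dim (S.projectParams lam) → ℂ}
    (hf : f' ∈ dualRing S (S.projectParams lam)) : ∃ f ∈ dualRing S.increment lam,
      ∀ x y, Corresponds (lam .centre) x.1 y.1 → f x = f' y := by
  induction hf using Algebra.adjoin_induction with
  | mem f hf =>
    rcases hf with ⟨s, t, rfl⟩ | ⟨p, q, a, b, rfl⟩ | ⟨p, q, a, b, rfl⟩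
    · refine ⟨_, sub_mem (dualResidue_mem_dualRing (S := S.increment) s t)
        (const_mem_dualRing ((Matrix.scalar S.OuterIndex (lam .centre)) s t)), fun x y h => ?_⟩
      exact sub_eq_of_eq_add (congrFun (congrFun h.1 s) t)
    · refine ⟨_, outerRep_fst_mem_dualRing (S := S.increment) p q a b, fun x y h => ?_⟩
      exact congrFun (congrFun (congrArg Prod.fst (congrFun (congrFun h.2 p) q)) a) b
    · refine ⟨_, outerRep_snd_mem_dualRing (S := S.increment) p q a b, fun x y h => ?_⟩
      exact congrFun (congrFun (congrArg Prod.snd (congrFun (congrFun h.2 p) q)) a) b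
  | algebraMap r => exact ⟨_, (dualRing S.increment lam).algebraMap_mem r, fun _ _ _ => rfl⟩
  | add f g _ _ hf hg =>
    obtain ⟨f', hf', h1⟩ := hf
    obtain ⟨g', hg', h2⟩ := hg
    exact ⟨_, add_mem hf' hg', fun x y h => congrArg₂ (· + ·) (h1 x y h) (h2 x y h)⟩
  | mul f g _ _ hf hg =>
    obtain ⟨f', hf', h1⟩ := hf
    obtain ⟨g', hg', h2⟩ := hg
    exact ⟨_, mul_mem hf' hg', fun x y h => congrArg₂ (· * ·) (h1 x y h) (h2 x y h)⟩

/-! ### Transfer of gauge transformations and of invariants. -/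

/-- The element of the gauge group of the incremented quiver which is given on the legs other than
the last one and trivial elsewhere. -/
def incGauge (g : GaugeGroup S.dim) : GaugeGroup S.increment.dim
  | .leg (some i) a => g (S.outer ⟨i, a⟩)
  | .leg none _ => 1
  | .centre => 1

/-- The element of the gauge group of the original quiver which is given on the legs other than
the last one and trivial elsewhere. -/
def projGauge (g : GaugeGroup S.increment.dim) : GaugeGroup S.dim
  | .leg (some i) a => g (S.increment.outer ⟨i, a⟩)
  | .leg none _ => 1
  | .centre => 1

theorem conj_add_scalar (g : GaugeGroup S.dim) (M : Matrix S.OuterIndex S.OuterIndex ℂ) (c : ℂ) :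
    outerGauge g * (M + Matrix.scalar _ c) * outerGauge g⁻¹ =
      outerGauge g * M * outerGauge g⁻¹ + Matrix.scalar _ c := by
  rw [Matrix.mul_add, Matrix.add_mul,
    ← (Matrix.scalar_commute c (fun r => mul_comm _ _) (outerGauge g)).eq,
    Matrix.mul_assoc (Matrix.scalar _ c), outerGauge_mul_inv, Matrix.mul_one]

theorem Corresponds.incGauge {c : ℂ} {x : RepSpace S.increment.dim} {y : RepSpace S.dim}
    (h : Corresponds c x y) (g : GaugeGroup S.dim) :
    Corresponds c (gaugeAct (incGauge g) x) (gaugeAct g y) := by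
  constructor
  · have h1 : incDualResidue (gaugeAct (StarData.incGauge g) x) =
        outerGauge g * incDualResidue x * outerGauge g⁻¹ :=
      dualResidue_gaugeAct (S := S.increment) (StarData.incGauge g) x
    rw [h1, h.1, dualResidue_gaugeAct, conj_add_scalar]
  · rw [outerRep_gaugeAct, ← h.2]
    exact outerRep_gaugeAct (S := S.increment) (StarData.incGauge g) x

theorem Corresponds.projGauge {c : ℂ} {x : RepSpace S.increment.dim} {y : RepSpace S.dim}
    (h : Corresponds c x y) (g : GaugeGroup S.increment.dim) :
    Corresponds c (gaugeAct g x) (gaugeAct (projGauge g) y) := by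
  constructor
  · have h1 : incDualResidue (gaugeAct g x) =
        outerGauge (StarData.projGauge g) * incDualResidue x *
          outerGauge (StarData.projGauge g)⁻¹ := dualResidue_gaugeAct (S := S.increment) g x
    rw [h1, h.1, dualResidue_gaugeAct, conj_add_scalar]
  · rw [outerRep_gaugeAct, ← h.2]
    exact outerRep_gaugeAct (S := S.increment) g x

end Transfer

/-- An invariant is a polynomial in the dual residue and the outer maps, and such polynomials
transfer along the correspondence. Invariance transfers too, since only the components of a gauge
transformation on the other legs act on these data, and scalar shifts commute with conjugation. -/
theorem nonempty_invariantRing_algEquiv (hS : S.IsAlmostAffine) (lam : S.increment.Vertex → ℂ)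
    (hgen : S.increment.IsGeneric lam) :
    Nonempty (invariantRing S.increment.dim lam ≃ₐ[ℂ]
      invariantRing S.dim (S.projectParams lam)) := by
  refine nonempty_algEquiv_of_rel (fun x y => Corresponds (lam .centre) x.1 y.1)
    (fun x => ?_) (fun y => ?_) (fun f hf => ?_) fun f' hf' => ?_
  · obtain ⟨y, hy, h⟩ := exists_corresponds_of_increment lam hS hgen x.2
    exact ⟨⟨y, hy⟩, h⟩
  · obtain ⟨x, hx, h⟩ := exists_corresponds_of_projected lam hS hgen y.2
    exact ⟨⟨x, hx⟩, h⟩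
  · obtain ⟨f', hf', h⟩ := exists_dualRing_of_increment lam
      ((incSpectralData hS lam hgen).invariantRing_le_dualRing hf)
    -- Invariance of the transferred function: choose a corresponding point on the other side and
    -- move it by the gauge transformation with the same components on the other legs.
    refine ⟨f', ⟨dualRing_le hf', fun g y y' hy => ?_⟩, h⟩
    obtain ⟨x, hx, hxy⟩ := exists_corresponds_of_projected lam hS hgen y.2
    have hx' := gaugeAct_mem_momentFibre (incGauge g) hx
    rw [← h ⟨x, hx⟩ y hxy, ← h ⟨_, hx'⟩ y' (by rw [hy]; exact hxy.incGauge g)]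
    exact hf.2 (incGauge g) ⟨x, hx⟩ ⟨_, hx'⟩ rfl
  · obtain ⟨f, hf, h⟩ := exists_dualRing_of_projected lam
      ((projSpectralData hS lam hgen).invariantRing_le_dualRing hf')
    refine ⟨f, ⟨dualRing_le hf, fun g x x' hx => ?_⟩, h⟩
    obtain ⟨y, hy, hxy⟩ := exists_corresponds_of_increment lam hS hgen x.2
    have hy' := gaugeAct_mem_momentFibre (projGauge g) hy
    rw [h x ⟨y, hy⟩ hxy, h x' ⟨_, hy'⟩ (by rw [hx]; exact hxy.projGauge g)]
    exact hf'.2 (projGauge g) ⟨y, hy⟩ ⟨_, hy'⟩ rfl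

end StarData

end

/-- For generic parameters `lam` of the incremented quiver with `lam · Δ = 0`, its quiver variety at
`lam` is isomorphic, as a variety over `ℂ`, to the quiver variety of the original almost affine
quiver at `pr(lam)`. -/
theorem mainTheorem2 {k : ℕ} (S : StarData (Option (Fin k))) (hS : S.IsAlmostAffine)
    (lam : S.increment.Vertex → ℂ)
    (hlam : ∑ v : S.increment.Vertex, lam v * (S.increment.dim v : ℂ) = 0)
    (hgen : S.increment.IsGeneric lam) :
    Nonempty (quiverVariety S.increment.dim lam ≅ quiverVariety S.dim (S.projectParams lam)) := by
  obtain ⟨e⟩ := StarData.nonempty_invariantRing_algEquiv hS lam hgen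
  exact nonempty_iso_of_algEquiv e
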